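/- **Theorem 1.** Let $H\in(\tfrac12,1)$, $T>0$, $x_0\in\mathbb R$, and let $a,b,\sigma$ be measurable real functions with $\sigma>0$ on $[0,\infty)$. Let $(W^{H,j})_{j\ge1}$ be independent normalized fractional Brownian motions with Hurst index $H$ (centered Gaussian processes with $\mathbb E(W^{H}_tW^{H}_s)=\frac12(t^{2H}+s^{2H}-|t-s|^{2H})$), and let $(\phi_j)_{j\ge1}$ be i.i.d. real random variables, independent of $(W^{H,j})_{j\ge1}$, with a common density $f$ supported on $[0,1]$. For each $j$ let $X^j$ be a continuous solution of $$dX^j_t=\bigl(a(X^j_t)+\phi_j\,b(t)\bigr)dt+\sigma(t)\,dW^{H,j}_t,\qquad X^j_0=x_0 .$$ Put $$k_H(t,s)=\kappa_H^{-1}s^{\frac12-H}(t-s)^{\frac12-H}\mathbf 1_{(0,t)}(s),\quad \kappa_H=2H\,\Gamma(\tfrac32-H)\Gamma(H+\tfrac12),$$ $$w^H_t=\lambda_H^{-1}t^{2-2H},\quad \lambda_H=\frac{2H\,\Gamma(3-2H)\Gamma(H+\frac12)}{\Gamma(\frac32-H)},$$ $$J_1^j(t)=\frac{d}{dw^H_t}\int_0^tk_H(t,s)\frac{a(X^j_s)}{\sigma(s)}ds,\qquad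 J_2(t)=\frac{d}{dw^H_t}\int_0^tk_H(t,s)\frac{b(s)}{\sigma(s)}ds,\qquad Z^j_t=\int_0^t\frac{k_H(t,s)}{\sigma(s)}dX^j_s .$$ Assume that these derivatives are well defined (almost surely, for $J_1^j$), in the sense that the integrals $\int_0^t k_H(t,s)c(s)\,ds$ with $c=a(X^j)/\sigma$ and $c=b/\sigma$ exist for every $t>0$ and are absolutely continuous functions of $t$ on every bounded interval $[0,S]$, and that almost surely $\int_0^S J_1^j(t)^2dw^H_t<\infty$ for all $S>0$. Here integrals of deterministic functions against $W^{H,j}$ are Wiener integrals, $\int_0^t h\,dX^j=\int_0^t h(s)(a(X^j_s)+\phi_jb(s))ds+\int_0^t h(s)\sigma(s)dW^{H,j}_s$, and $\int_0^TJ_2\,dZ^j$ is the stochastic integral against the semimartingale $Z^j$, i.e. the limit in probability of the elementary integrals of step functions converging to $J_2$ in $L^2([0,T],dw^H)$. Let $$\hat\phi_{j,T}=\frac{\int_0^TJ_2(t)\,dZ^j_t-\int_0^TJ_1^j(t)J_2(t)\,dw^H_t}{\int_0^TJ_2(t)^2\,dw^H_t},\qquad \hat F_n(y)=\frac1n\sum_{j=1}^n\mathbf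 1_{\{\hat\phi_{j,T}\le y\}},$$ $$\hat f_{m,n}(x)=m\sum_{k=0}^{m-1}\Bigl[\hat F_n\bigl(\tfrac{k+1}m\bigr)-\hat F_n\bigl(\tfrac km\bigr)\Bigr]p_k(m-1,x),\qquad p_k(m,x)=\binom mk x^k(1-x)^{m-k}.$$ Fix $x\in[0,1]$ and assume: * (A1) $\int_0^SJ_2(t)^2dw^H_t<\infty$ for every $S>0$; * (A2) $\lim_{S\to\infty}\int_0^SJ_2(t)^2dw^H_t=\infty$; * (A3) $f$ is twice continuously differentiable on $[0,1]$; * (A4) $\hat\phi_{1,T}$ has a positive density $g$ on $\mathbb R$ that is continuous at $x$. Let $m=m_n$ be positive integers with $m_n\to\infty$ and $m_n/n\to0$ as $n\to\infty$ ($T$ is fixed). Then, as $n\to\infty$, with $\psi(x)=(4\pi x(1-x))^{-1/2}$: 1. if $x\in(0,1)$, then $n^{1/2}m^{-1/4}\bigl[\hat f_{m,n}(x)-\mathbb E\hat f_{m,n}(x)\bigr]$ converges in law to $\mathcal N\bigl(0,g(x)\psi(x)\bigr)$; 2. if $x\in\{0,1\}$, then $n^{1/2}m^{-1/2}\bigl[\hat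 f_{m,n}(x)-\mathbb E\hat f_{m,n}(x)\bigr]$ converges in law to $\mathcal N\bigl(0,g(x)\bigr)$. -/

import Mathlib

open MeasureTheory ProbabilityTheory Filter Set
open scoped Topology NNReal ENNReal

/-!
Stochastic processes are functions `Y : ℝ → Ω → ℝ` of a real time variable; only the times
`t ≥ 0` are ever used.
-/

namespace FracRE

noncomputable section

variable {Ω : Type*} [MeasurableSpace Ω]

/-- Normalized fractional Brownian motion `(W t)_{t ≥ 0}` with Hurst index `H`: a centered Gaussian
process with covariance `(t^{2H} + s^{2H} - |t - s|^{2H}) / 2`. -/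
structure IsFBM (P : Measure Ω) (H : ℝ) (W : ℝ → Ω → ℝ) : Prop where
  measurable : ∀ t, 0 ≤ t → Measurable (W t)
  gaussian : IsGaussianProcess (fun t : ℝ≥0 => W t) P
  centered : ∀ t, 0 ≤ t → ∫ ω, W t ω ∂P = 0
  covariance : ∀ s t, 0 ≤ s → 0 ≤ t →
    ∫ ω, W t ω * W s ω ∂P = (t ^ (2 * H) + s ^ (2 * H) - |t - s| ^ (2 * H)) / 2

/-! ### Integrals of deterministic functions against processes -/

/-- A step function `∑ i, coef i • 1_{(left i, right i]}` on `(0, t]`. -/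
structure StepFun (t : ℝ) where
  card : ℕ
  left : Fin card → ℝ
  right : Fin card → ℝ
  coef : Fin card → ℝ
  nonneg : ∀ i, 0 ≤ left i
  le : ∀ i, left i ≤ right i
  le_end : ∀ i, right i ≤ t

/-- The underlying function of a step function. -/
def StepFun.toFun {t : ℝ} (s : StepFun t) (u : ℝ) : ℝ :=
  ∑ i, (Ioc (s.left i) (s.right i)).indicator (fun _ => s.coef i) u

/-- The elementary integral of a step function against a path `y`. -/
def StepFun.integral {t : ℝ} (s : StepFun t) (y : ℝ → ℝ) : ℝ :=
  ∑ i, s.coef i * (y (s.right i) - y (s.left i))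

/-- `I` is the integral `∫_0^t h dY`, obtained by extending the elementary integral of step
functions continuously from the (pseudo-)norm `N` on integrands to convergence in probability:
`h` lies in the `N`-closure of the step functions on `(0, t]`, and the elementary integrals of
step functions converging to `h` for `N` converge to `I` in probability. -/
def IsExtendedIntegral (P : Measure Ω) (N : (ℝ → ℝ) → ℝ≥0∞) (Y : ℝ → Ω → ℝ) (h : ℝ → ℝ) (t : ℝ)
    (I : Ω → ℝ) : Prop :=
  (∃ s : ℕ → StepFun t, Tendsto (fun n => N (fun u => h u - (s n).toFun u)) atTop (𝓝 0)) ∧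
  ∀ s : ℕ → StepFun t, Tendsto (fun n => N (fun u => h u - (s n).toFun u)) atTop (𝓝 0) →
    TendstoInMeasure P (fun n ω => (s n).integral (fun u => Y u ω)) atTop I

/-- The (squared) norm `H (2H - 1) ∫_0^t ∫_0^t |h u| |h v| |u - v|^{2H - 2} du dv` of the usual
space of deterministic integrands for fractional Brownian motion with `H > 1/2`. -/
def fbmNormSq (H t : ℝ) (h : ℝ → ℝ) : ℝ≥0∞ :=
  ∫⁻ u in Ioc 0 t, ∫⁻ v in Ioc 0 t,
    ENNReal.ofReal (H * (2 * H - 1) * |h u| * |h v| * |u - v| ^ (2 * H - 2))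

/-- `I` is the Wiener integral `∫_0^t h dW` of the deterministic function `h` with respect to the
fractional Brownian motion `W` with Hurst index `H`. -/
def IsWienerIntegral (P : Measure Ω) (H : ℝ) (W : ℝ → Ω → ℝ) (h : ℝ → ℝ) (t : ℝ) (I : Ω → ℝ) :
    Prop :=
  IsExtendedIntegral P (fbmNormSq H t) W h t I

/-- `X` is a solution of `dX_t = (a(X_t) + φ b(t)) dt + σ(t) dW_t`, `X_0 = x₀`. -/
structure IsSolution (P : Measure Ω) (H : ℝ) (a b σ : ℝ → ℝ) (x₀ : ℝ) (φ : Ω → ℝ)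
    (W X : ℝ → Ω → ℝ) : Prop where
  measurable : ∀ t, 0 ≤ t → Measurable (X t)
  continuous : ∀ᵐ ω ∂P, ContinuousOn (fun t => X t ω) (Ici 0)
  initial : ∀ᵐ ω ∂P, X 0 ω = x₀
  integrable : ∀ᵐ ω ∂P, ∀ t, 0 < t →
    IntegrableOn (fun s => a (X s ω) + φ ω * b s) (Ioc 0 t)
  equation : ∀ t, 0 ≤ t → IsWienerIntegral P H W σ t
    (fun ω => X t ω - x₀ - ∫ s in Ioc 0 t, (a (X s ω) + φ ω * b s))

/-- For `X` with stochastic differential `dX_s = (a(X_s) + φ b(s)) ds + σ(s) dW_s`, the random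
variable `I` is the integral
`∫_0^t h(s) dX_s = ∫_0^t h(s) (a(X_s) + φ b(s)) ds + ∫_0^t h(s) σ(s) dW_s`. -/
def IsDiffusionIntegral (P : Measure Ω) (H : ℝ) (a b σ : ℝ → ℝ) (φ : Ω → ℝ) (W X : ℝ → Ω → ℝ)
    (h : ℝ → ℝ) (t : ℝ) (I : Ω → ℝ) : Prop :=
  (∀ᵐ ω ∂P, IntegrableOn (fun s => h s * (a (X s ω) + φ ω * b s)) (Ioc 0 t)) ∧
  IsWienerIntegral P H W (fun s => h s * σ s) t
    (fun ω => I ω - ∫ s in Ioc 0 t, h s * (a (X s ω) + φ ω * b s))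

/-! ### The kernel `k_H`, the function `w^H` and the functions `J_1`, `J_2` -/

/-- `κ_H = 2H Γ(3/2 - H) Γ(H + 1/2)`. -/
def kappa (H : ℝ) : ℝ := 2 * H * Real.Gamma (3 / 2 - H) * Real.Gamma (H + 1 / 2)

/-- `k_H(t, s) = κ_H⁻¹ s^{1/2 - H} (t - s)^{1/2 - H} 1_{(0,t)}(s)`. -/
def kernel (H t s : ℝ) : ℝ :=
  (Ioo 0 t).indicator
    (fun s => (kappa H)⁻¹ * s ^ (1 / 2 - H) * (t - s) ^ (1 / 2 - H)) s

/-- `λ_H = 2H Γ(3 - 2H) Γ(H + 1/2) / Γ(3/2 - H)`. -/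
def lam (H : ℝ) : ℝ :=
  2 * H * Real.Gamma (3 - 2 * H) * Real.Gamma (H + 1 / 2) / Real.Gamma (3 / 2 - H)

/-- `w^H_t = λ_H⁻¹ t^{2 - 2H}`. -/
def w (H t : ℝ) : ℝ := (lam H)⁻¹ * t ^ (2 - 2 * H)

/-- The measure `dw^H_t` on `(0, ∞)`, that is `(w^H)'(t) dt`. -/
def dw (H : ℝ) : Measure ℝ :=
  (volume.restrict (Ioi 0)).withDensity (fun t => ENNReal.ofReal (deriv (w H) t))

/-- `t ↦ ∫_0^t k_H(t, s) c(s) ds`. -/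
def kernelInt (H : ℝ) (c : ℝ → ℝ) (t : ℝ) : ℝ := ∫ s in Ioc 0 t, kernel H t s * c s

/-- The derivative `d/dw^H_t ∫_0^t k_H(t, s) c(s) ds`. This is `J_2` for `c = b / σ` and `J_1^j` for
`c = a(X^j) / σ`. -/
def J (H : ℝ) (c : ℝ → ℝ) (t : ℝ) : ℝ := deriv (kernelInt H c) t / deriv (w H) t

/-- `c` is such that the derivative `J H c` is well defined: the integrals `∫_0^t k_H(t, s) c(s) ds`
exist and form an absolutely continuous function of `t` on every `[0, T]`. -/
def HasJ (H : ℝ) (c : ℝ → ℝ) : Prop :=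
  (∀ t, 0 < t → IntegrableOn (fun s => kernel H t s * c s) (Ioc 0 t)) ∧
  ∀ T, 0 < T → AbsolutelyContinuousOnInterval (kernelInt H c) 0 T

/-- `J_2(t) = d/dw^H_t ∫_0^t k_H(t, s) b(s) / σ(s) ds`. -/
def J₂ (H : ℝ) (b σ : ℝ → ℝ) : ℝ → ℝ := J H (fun s => b s / σ s)

/-- `J_1(t) = d/dw^H_t ∫_0^t k_H(t, s) a(x(s)) / σ(s) ds` along the path `x`. -/
def J₁ (H : ℝ) (a σ x : ℝ → ℝ) : ℝ → ℝ := J H (fun s => a (x s) / σ s)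

/-- `I` is the stochastic integral `∫_0^T h dZ` of a deterministic `h ∈ L²([0,T], dw^H)` with
respect to a semimartingale `Z` with quadratic variation `w^H`. -/
def IsSemimartingaleIntegral (P : Measure Ω) (H : ℝ) (Z : ℝ → Ω → ℝ) (h : ℝ → ℝ) (T : ℝ)
    (I : Ω → ℝ) : Prop :=
  IsExtendedIntegral P (fun h => eLpNorm h 2 ((dw H).restrict (Ioc 0 T))) Z h T I

/-! ### The estimators -/

/-- The maximum likelihood estimator of a random effect,
`(∫_0^T J_2 dZ - ∫_0^T J_1 J_2 dw^H) / ∫_0^T J_2² dw^H`, from the path `x` observed on `[0, T]` and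
the value `I` of `∫_0^T J_2 dZ`. -/
def phiHat (H : ℝ) (a b σ : ℝ → ℝ) (T : ℝ) (x : ℝ → ℝ) (I : ℝ) : ℝ :=
  (I - ∫ t in Ioc 0 T, J₁ H a σ x t * J₂ H b σ t ∂(dw H)) /
    ∫ t in Ioc 0 T, J₂ H b σ t ^ 2 ∂(dw H)

/-- Empirical distribution function of the first `n` terms of the sample `y`. -/
def empCDF (y : ℕ → ℝ) (n : ℕ) (u : ℝ) : ℝ :=
  (1 / (n : ℝ)) * ∑ j ∈ Finset.range n, (Iic u).indicator (fun _ => (1 : ℝ)) (y j)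

/-- Bernstein density estimator of order `m` from the first `n` terms of the sample `y`. -/
def bernsteinEstimator (y : ℕ → ℝ) (m n : ℕ) (x : ℝ) : ℝ :=
  m * ∑ k ∈ Finset.range m,
    (empCDF y n (((k : ℝ) + 1) / m) - empCDF y n ((k : ℝ) / m)) *
      (bernsteinPolynomial ℝ (m - 1) k).eval x

/-- `ψ(x) = (4 π x (1 - x))^{-1/2}`. -/
def psi (x : ℝ) : ℝ := (4 * Real.pi * x * (1 - x)) ^ (-(1 / 2) : ℝ)

/-- `h` is a probability density of the real random variable `Y`. -/
def IsDensity (P : Measure Ω) (Y : Ω → ℝ) (h : ℝ → ℝ) : Prop :=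
  AEMeasurable Y P ∧ Measurable h ∧ (∀ y, 0 ≤ h y) ∧
    P.map Y = volume.withDensity (fun y => ENNReal.ofReal (h y))

end

end FracRE

/-!
Integrating the Volterra kernel against the equation shows that `Z^j = ∫ (J₁^j + φ_j J₂) dw^H + M^j`
with a Gaussian process `M^j` that is one fixed measurable functional of the path of `W^{H,j}`.
Hence `φ̂_{j,T} = φ_j + ∫ J₂ dM^j / ∫ J₂² dw^H` is, up to null sets, the same measurable function of
`(φ_j, W^{H,j})` for every `j`, and the estimators are independent and identically distributed.

The Bernstein estimator is the sample mean of `K_m(φ̂_j)`, where `K_m` is bounded by `m √S_m` and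
`S_m = ∑_k p_k(m - 1, x)²`. Since the binomial weights concentrate at `x`, where the distribution
function of `φ̂_1` has strict derivative `g x`, the variance of `K_m(φ̂_1)` is asymptotic to
`g x * m S_m`, and the central limit theorem for triangular arrays applies once `m / n → 0`. On the
boundary `S_m = 1`; inside, Parseval writes `S_m` as the mean of `|x e^{iθ} + 1 - x|^{2(m-1)}`
over `θ`, and Laplace's method gives `√m S_m → ψ(x)`.
-/

namespace FracRE

section Processes

variable {Ω Ω' : Type*} [MeasurableSpace Ω] [MeasurableSpace Ω'] {P : Measure Ω} {P' : Measure Ω'}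

theorem charFunDual_map_of_hasGaussianLaw {ι : Type*} [Fintype ι] {X : ι → Ω → ℝ}
    (hX : HasGaussianLaw (fun ω i => X i ω) P) (L : StrongDual ℝ (ι → ℝ)) :
    charFunDual (P.map fun ω i => X i ω) L =
      Complex.exp ((∑ i, L (Pi.basisFun ℝ ι i) * P[X i] : ℝ) * Complex.I -
        (∑ i, ∑ j, L (Pi.basisFun ℝ ι i) * (L (Pi.basisFun ℝ ι j) * cov[X i, X j; P]) : ℝ) /
          2) := by
  have := hX.isGaussian_map
  have := hX.isProbabilityMeasure
  have hL : ∀ p : ι → ℝ, L p = ∑ i, L (Pi.basisFun ℝ ι i) * p i := fun p => by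
    conv_lhs => rw [← (Pi.basisFun ℝ ι).sum_repr p]
    simp [mul_comm]
  have hLp : ∀ i, MemLp (fun ω => L (Pi.basisFun ℝ ι i) * X i ω) 2 P := fun i =>
    (hX.eval i).memLp_two.const_mul _
  have hLX : L ∘ (fun ω i => X i ω) = fun ω => ∑ i, L (Pi.basisFun ℝ ι i) * X i ω :=
    funext fun ω => hL _
  have hmean : P[L ∘ fun ω i => X i ω] = ∑ i, L (Pi.basisFun ℝ ι i) * P[X i] := by
    rw [hLX, integral_finsetSum _ fun i _ => (hLp i).integrable one_le_two]
    simp only [integral_const_mul]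
  have hvar : Var[L ∘ fun ω i => X i ω; P] =
      ∑ i, ∑ j, L (Pi.basisFun ℝ ι i) * (L (Pi.basisFun ℝ ι j) * cov[X i, X j; P]) := by
    rw [hLX, ← covariance_self (memLp_finsetSum _ fun i _ => hLp i).1.aemeasurable,
      covariance_fun_sum_fun_sum hLp hLp]
    exact Finset.sum_congr rfl fun i _ => Finset.sum_congr rfl fun j _ => by
      rw [covariance_const_mul_left, covariance_const_mul_right]
  rw [IsGaussian.charFunDual_eq, integral_map hX.aemeasurable (by fun_prop),
    variance_map (by fun_prop) hX.aemeasurable, hvar, integral_complex_ofReal,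
    ← hmean]
  rfl

theorem map_eq_of_isGaussianProcess {T : Type*} {X : T → Ω → ℝ} {Y : T → Ω' → ℝ}
    (hX : IsGaussianProcess X P) (hY : IsGaussianProcess Y P')
    (hXm : AEMeasurable (fun ω t => X t ω) P) (hYm : AEMeasurable (fun ω t => Y t ω) P')
    (hmean : ∀ t, P[X t] = P'[Y t]) (hcov : ∀ s t, cov[X s, X t; P] = cov[Y s, Y t; P']) :
    P.map (fun ω t => X t ω) = P'.map (fun ω t => Y t ω) := by
  have := hX.isProbabilityMeasure
  have := hY.isProbabilityMeasure
  refine IsProjectiveLimit.unique (isProjectiveLimit_map hXm) fun I => ?_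
  rw [isProjectiveLimit_map hYm I]
  refine Measure.ext_of_charFunDual (funext fun L => ?_)
  have hXL := charFunDual_map_of_hasGaussianLaw (X := fun (i : I) => X i) (hX.hasGaussianLaw I) L
  have hYL := charFunDual_map_of_hasGaussianLaw (X := fun (i : I) => Y i) (hY.hasGaussianLaw I) L
  simp only [hmean, hcov] at hXL
  exact hYL.trans hXL.symm

theorem iIndepFun_prodMk_of_indepFun {ι : Type*} {𝓤 𝓥 : ι → Type*} [∀ j, MeasurableSpace (𝓤 j)]
    [∀ j, MeasurableSpace (𝓥 j)] {U : ∀ j, Ω → 𝓤 j} {V : ∀ j, Ω → 𝓥 j}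
    (hU : ∀ j, Measurable (U j)) (hV : ∀ j, Measurable (V j)) (hUi : iIndepFun U P)
    (hVi : iIndepFun V P) (hUV : IndepFun (fun ω j => U j ω) (fun ω j => V j ω) P) :
    iIndepFun (fun j ω => (U j ω, V j ω)) P := by
  have := hUi.isProbabilityMeasure
  refine iIndepSets.iIndep (fun j => ((hU j).prodMk (hV j)).comap_le)
    (fun j => preimage (fun ω => (U j ω, V j ω)) ''
      image2 (· ×ˢ ·) {A | MeasurableSet A} {B | MeasurableSet B})
    (fun j => isPiSystem_prod.comap _)
    (fun j => by simp only [← generateFrom_prod, MeasurableSpace.comap_generateFrom]) ?_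
  rw [iIndepSets_iff]
  intro s f hf
  have hf' : ∀ j ∈ s, ∃ A B, MeasurableSet A ∧ MeasurableSet B ∧ f j = U j ⁻¹' A ∩ V j ⁻¹' B := by
    intro j hj
    obtain ⟨_, ⟨A, hA, B, hB, rfl⟩, hAB⟩ := hf j hj
    exact ⟨A, B, hA, hB, hAB.symm.trans (mk_preimage_prod _ _)⟩
  choose! A B hA hB hAB using hf'
  have hinter : P (⋂ j ∈ s, f j) = P (⋂ j ∈ s, U j ⁻¹' A j) * P (⋂ j ∈ s, V j ⁻¹' B j) := by
    have h := hUV.measure_inter_preimage_eq_mul _ _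
      (.pi s.countable_toSet fun j hj => hA j hj) (.pi s.countable_toSet fun j hj => hB j hj)
    simp only [Set.pi_def, preimage_iInter, ← preimage_comp, Finset.mem_coe] at h
    simp only [iInter₂_congr hAB, iInter_inter_distrib]
    exact h
  have hpair : ∀ j ∈ s, P (f j) = P (U j ⁻¹' A j) * P (V j ⁻¹' B j) := fun j hj => by
    rw [hAB j hj]
    exact (hUV.comp (measurable_pi_apply j)
      (measurable_pi_apply j)).measure_inter_preimage_eq_mul _ _ (hA j hj) (hB j hj)
  rw [hinter, hUi.measure_inter_preimage_eq_mul s hA, hVi.measure_inter_preimage_eq_mul s hB,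
    ← Finset.prod_mul_distrib, Finset.prod_congr rfl hpair]

end Processes

section SubsequenceLimits

variable {Ω : Type*} [MeasurableSpace Ω] {P : Measure Ω}

/-- Convergence in probability in its subsequence form: every subsequence of `f` has a further
subsequence converging to `g` almost surely. Unlike for `TendstoInMeasure`, limits can be added
without assuming that `f` and `g` are measurable. -/
def TendstoAESubseq (P : Measure Ω) (f : ℕ → Ω → ℝ) (g : Ω → ℝ) : Prop :=
  ∀ ns : ℕ → ℕ, StrictMono ns → ∃ ms : ℕ → ℕ, StrictMono ms ∧
    ∀ᵐ ω ∂P, Tendsto (fun i => f (ns (ms i)) ω) atTop (𝓝 (g ω))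

theorem tendstoAESubseq_of_tendstoInMeasure {f : ℕ → Ω → ℝ} {g : Ω → ℝ}
    (h : TendstoInMeasure P f atTop g) : TendstoAESubseq P f g := fun _ hns =>
  (h.comp hns.tendsto_atTop).exists_seq_tendsto_ae

theorem TendstoAESubseq.congr_ae {f f' : ℕ → Ω → ℝ} {g : Ω → ℝ} (h : TendstoAESubseq P f g)
    (hff' : ∀ n, f n =ᵐ[P] f' n) : TendstoAESubseq P f' g := fun ns hns => by
  obtain ⟨ms, hms, hlim⟩ := h ns hns
  refine ⟨ms, hms, ?_⟩
  filter_upwards [hlim, ae_all_iff.2 hff'] with ω hω hω'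
  exact hω.congr fun i => hω' _

theorem TendstoAESubseq.sub_ae {f f' : ℕ → Ω → ℝ} {g g' : Ω → ℝ} (h : TendstoAESubseq P f g)
    (h' : ∀ᵐ ω ∂P, Tendsto (fun n => f' n ω) atTop (𝓝 (g' ω))) :
    TendstoAESubseq P (fun n ω => f n ω - f' n ω) (fun ω => g ω - g' ω) := fun ns hns => by
  obtain ⟨ms, hms, hlim⟩ := h ns hns
  refine ⟨ms, hms, ?_⟩
  filter_upwards [hlim, h'] with ω hω hω'
  exact hω.sub (hω'.comp (hns.comp hms).tendsto_atTop)

theorem exists_measurable_ae_eq_comp_of_tendstoAESubseq {ι 𝓢 : Type*} [Nonempty ι]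
    [MeasurableSpace 𝓢] {V : ι → Ω → 𝓢} (hV : ∀ i j, IdentDistrib (V i) (V j) P P)
    {E : ℕ → 𝓢 → ℝ} (hE : ∀ n, Measurable (E n)) {L : ι → Ω → ℝ}
    (hL : ∀ i, TendstoAESubseq P (fun n ω => E n (V i ω)) (L i)) :
    ∃ Φ : 𝓢 → ℝ, Measurable Φ ∧ ∀ i, L i =ᵐ[P] fun ω => Φ (V i ω) := by
  obtain ⟨i₀⟩ := ‹Nonempty ι›
  obtain ⟨ns, hns, hconv⟩ := hL i₀ id strictMono_id
  have hconv_law : ∀ᵐ v ∂(P.map (V i₀)), ∃ l, Tendsto (fun n => E (ns n) v) atTop (𝓝 l) :=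
    (ae_map_iff (hV i₀ i₀).aemeasurable_fst
      (measurableSet_exists_tendsto fun n => hE (ns n))).2 (hconv.mono fun _ hω => ⟨_, hω⟩)
  obtain ⟨Φ, hΦ, hΦlim⟩ := measurable_limit_of_tendsto_metrizable_ae
    (fun n => (hE (ns n)).aemeasurable) hconv_law
  refine ⟨Φ, hΦ, fun i => ?_⟩
  have hΦi : ∀ᵐ ω ∂P, Tendsto (fun n => E (ns n) (V i ω)) atTop (𝓝 (Φ (V i ω))) :=
    ae_of_ae_map (hV i i).aemeasurable_fst (by rwa [(hV i i₀).map_eq])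
  obtain ⟨ms, hms, hlim⟩ := hL i ns hns
  filter_upwards [hΦi, hlim] with ω hω hω'
  exact tendsto_nhds_unique hω' (hω.comp hms.tendsto_atTop)

end SubsequenceLimits

section DerivativeInW

theorem lam_pos {H : ℝ} (hH : H ∈ Ioo (0 : ℝ) (3 / 2)) : 0 < lam H := by
  obtain ⟨hH0, hH1⟩ := hH
  have := Real.Gamma_pos_of_pos (show 0 < 3 - 2 * H by linarith)
  have := Real.Gamma_pos_of_pos (show 0 < H + 1 / 2 by linarith)
  have := Real.Gamma_pos_of_pos (show 0 < 3 / 2 - H by linarith)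
  unfold lam
  positivity

theorem deriv_w_pos {H : ℝ} (hH : H ∈ Ioo (0 : ℝ) 1) {t : ℝ} (ht : 0 < t) :
    0 < deriv (w H) t := by
  have hderiv : HasDerivAt (w H) ((lam H)⁻¹ * ((2 - 2 * H) * t ^ (2 - 2 * H - 1))) t :=
    (Real.hasDerivAt_rpow_const (Or.inl ht.ne')).const_mul _
  have := lam_pos ⟨hH.1, by linarith [hH.2]⟩
  have : 0 < 2 - 2 * H := by linarith [hH.2]
  rw [hderiv.deriv]
  positivity

theorem restrict_dw (H T : ℝ) : (dw H).restrict (Ioc 0 T) =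
    (volume.restrict (Ioc 0 T)).withDensity (fun t => ENNReal.ofReal (deriv (w H) t)) := by
  rw [dw, restrict_withDensity measurableSet_Ioc, Measure.restrict_restrict measurableSet_Ioc,
    inter_eq_left.2 fun t ht => ht.1]

theorem setIntegral_dw {H : ℝ} (hH : H ∈ Ioo (0 : ℝ) 1) (T : ℝ) (f : ℝ → ℝ) :
    ∫ t in Ioc 0 T, f t ∂(dw H) = ∫ t in Ioc 0 T, deriv (w H) t * f t := by
  rw [restrict_dw, integral_withDensity_eq_integral_toReal_smul
    (measurable_deriv _).ennreal_ofReal (by simp)]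
  refine setIntegral_congr_fun measurableSet_Ioc fun t ht => ?_
  simp [ENNReal.toReal_ofReal (deriv_w_pos hH ht.1).le]

theorem integrableOn_dw_iff {H : ℝ} (hH : H ∈ Ioo (0 : ℝ) 1) (T : ℝ) (f : ℝ → ℝ) :
    IntegrableOn f (Ioc 0 T) (dw H) ↔ IntegrableOn (fun t => deriv (w H) t * f t) (Ioc 0 T) := by
  rw [IntegrableOn, restrict_dw, integrable_withDensity_iff_integrable_smul'
    (measurable_deriv _).ennreal_ofReal (by simp)]
  refine integrableOn_congr_fun (fun t ht => ?_) measurableSet_Ioc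
  simp [ENNReal.toReal_ofReal (deriv_w_pos hH ht.1).le]

theorem measurable_J (H : ℝ) (c : ℝ → ℝ) : Measurable (J H c) :=
  (measurable_deriv _).div (measurable_deriv _)

theorem deriv_w_mul_J {H : ℝ} (hH : H ∈ Ioo (0 : ℝ) 1) (c : ℝ → ℝ) {t : ℝ} (ht : 0 < t) :
    deriv (w H) t * J H c t = deriv (kernelInt H c) t :=
  mul_div_cancel₀ _ (deriv_w_pos hH ht).ne'

theorem HasJ.integrableOn {H : ℝ} (hH : H ∈ Ioo (0 : ℝ) 1) {c : ℝ → ℝ} (hc : HasJ H c) {T : ℝ}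
    (hT : 0 < T) : IntegrableOn (J H c) (Ioc 0 T) (dw H) := by
  have hderiv := (hc.2 T hT).intervalIntegrable_deriv
  rw [intervalIntegrable_iff_integrableOn_Ioc_of_le hT.le] at hderiv
  rw [integrableOn_dw_iff hH]
  exact hderiv.congr_fun (fun t ht => (deriv_w_mul_J hH c ht.1).symm) measurableSet_Ioc

theorem HasJ.kernelInt_sub {H : ℝ} (hH : H ∈ Ioo (0 : ℝ) 1) {c : ℝ → ℝ} (hc : HasJ H c)
    {T l r : ℝ} (hT : 0 < T) (hl : 0 ≤ l) (hlr : l ≤ r) (hr : r ≤ T) :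
    kernelInt H c r - kernelInt H c l =
      ∫ t in Ioc 0 T, (Ioc l r).indicator (J H c) t ∂(dw H) := by
  have hac : AbsolutelyContinuousOnInterval (kernelInt H c) l r :=
    (hc.2 T hT).mono (by
      rw [uIcc_of_le hlr, uIcc_of_le hT.le]; exact Icc_subset_Icc hl hr)
  have hderiv : ∀ t ∈ Ioc 0 T, deriv (w H) t * (Ioc l r).indicator (J H c) t =
      (Ioc l r).indicator (deriv (kernelInt H c)) t := fun t ht => by
    by_cases h : t ∈ Ioc l r
    · simp only [indicator_of_mem h, deriv_w_mul_J hH c ht.1]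
    · simp only [indicator_of_notMem h, mul_zero]
  rw [← hac.integral_deriv_eq_sub, intervalIntegral.integral_of_le hlr, setIntegral_dw hH,
    setIntegral_congr_fun measurableSet_Ioc hderiv, setIntegral_indicator measurableSet_Ioc,
    inter_eq_right.2 (Ioc_subset_Ioc hl hr)]

end DerivativeInW

section StepFunctions

variable {T : ℝ} (s : StepFun T)

theorem StepFun.left_mem_Icc (i : Fin s.card) : s.left i ∈ Icc 0 T :=
  ⟨s.nonneg i, (s.le i).trans (s.le_end i)⟩

theorem StepFun.right_mem_Icc (i : Fin s.card) : s.right i ∈ Icc 0 T :=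
  ⟨(s.nonneg i).trans (s.le i), s.le_end i⟩

theorem StepFun.measurable_toFun : Measurable s.toFun := by
  unfold StepFun.toFun
  exact Finset.measurable_sum _ fun i _ => measurable_const.indicator measurableSet_Ioc

theorem StepFun.abs_toFun_le (u : ℝ) : |s.toFun u| ≤ ∑ i, |s.coef i| :=
  (Finset.abs_sum_le_sum_abs _ _).trans
    (Finset.sum_le_sum fun i _ => norm_indicator_le_norm_self (fun _ => s.coef i) u)

theorem StepFun.integrable_toFun_mul {μ : Measure ℝ} {f : ℝ → ℝ} (hf : Integrable f μ) :
    Integrable (fun u => s.toFun u * f u) μ :=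
  hf.bdd_mul s.measurable_toFun.aestronglyMeasurable (Eventually.of_forall s.abs_toFun_le)

theorem StepFun.integral_add (y z : ℝ → ℝ) :
    s.integral (fun u => y u + z u) = s.integral y + s.integral z := by
  simp only [StepFun.integral, ← Finset.sum_add_distrib]
  exact Finset.sum_congr rfl fun i _ => by ring

theorem StepFun.integral_const_mul (r : ℝ) (y : ℝ → ℝ) :
    s.integral (fun u => r * y u) = r * s.integral y := by
  simp only [StepFun.integral, Finset.mul_sum]
  exact Finset.sum_congr rfl fun i _ => by ring

theorem StepFun.integral_sub (y z : ℝ → ℝ) :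
    s.integral (fun u => y u - z u) = s.integral y - s.integral z := by
  simp only [StepFun.integral, ← Finset.sum_sub_distrib]
  exact Finset.sum_congr rfl fun i _ => by ring

theorem StepFun.integral_congr {y z : ℝ → ℝ} (h : ∀ u ∈ Icc 0 T, y u = z u) :
    s.integral y = s.integral z :=
  Finset.sum_congr rfl fun i _ => by rw [h _ (s.left_mem_Icc i), h _ (s.right_mem_Icc i)]

theorem StepFun.measurable_integral {𝓢 : Type*} [MeasurableSpace 𝓢] {Y : ℝ → 𝓢 → ℝ}
    (hY : ∀ u ∈ Icc 0 T, Measurable (Y u)) : Measurable (fun v => s.integral (fun u => Y u v)) :=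
  Finset.measurable_sum _ fun i _ =>
    ((hY _ (s.right_mem_Icc i)).sub (hY _ (s.left_mem_Icc i))).const_mul _

theorem StepFun.integral_ae_eq {Ω : Type*} [MeasurableSpace Ω] {P : Measure Ω} {Y Z : ℝ → Ω → ℝ}
    (h : ∀ u ∈ Icc 0 T, Y u =ᵐ[P] Z u) :
    (fun ω => s.integral (fun u => Y u ω)) =ᵐ[P] fun ω => s.integral (fun u => Z u ω) := by
  filter_upwards [ae_all_iff.2 fun i => h _ (s.left_mem_Icc i),
    ae_all_iff.2 fun i => h _ (s.right_mem_Icc i)] with ω hleft hright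
  simp only [StepFun.integral, hleft, hright]

theorem StepFun.integral_kernelInt {H : ℝ} (hH : H ∈ Ioo (0 : ℝ) 1) {c : ℝ → ℝ} (hc : HasJ H c)
    (hT : 0 < T) :
    s.integral (kernelInt H c) = ∫ t in Ioc 0 T, s.toFun t * J H c t ∂(dw H) := by
  have hterm : ∀ t, s.toFun t * J H c t =
      ∑ i, s.coef i * (Ioc (s.left i) (s.right i)).indicator (J H c) t := fun t => by
    rw [StepFun.toFun, Finset.sum_mul]
    refine Finset.sum_congr rfl fun i _ => ?_
    by_cases h : t ∈ Ioc (s.left i) (s.right i) <;> simp [h]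
  simp only [hterm]
  rw [integral_finsetSum _ fun i _ =>
    ((hc.integrableOn hH hT).integrable.indicator measurableSet_Ioc).const_mul _]
  refine Finset.sum_congr rfl fun i _ => ?_
  rw [hc.kernelInt_sub hH hT (s.nonneg i) (s.le i) (s.le_end i), MeasureTheory.integral_const_mul]

theorem tendsto_integral_mul_of_tendsto_eLpNorm_two {α : Type*} [MeasurableSpace α] {μ : Measure α}
    {u h : α → ℝ} {f : ℕ → α → ℝ} (hu : MemLp u 2 μ) (hh : MemLp h 2 μ)
    (hf : ∀ n, AEStronglyMeasurable (f n) μ) (huf : ∀ n, Integrable (fun t => f n t * u t) μ)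
    (hlim : Tendsto (fun n => eLpNorm (fun t => h t - f n t) 2 μ) atTop (𝓝 0)) :
    Tendsto (fun n => ∫ t, f n t * u t ∂μ) atTop (𝓝 (∫ t, h t * u t ∂μ)) := by
  refine tendsto_integral_of_L1' _ (hh.integrable_mul hu).1 (Eventually.of_forall huf) ?_
  have hbound : Tendsto (fun n => eLpNorm (fun t => h t - f n t) 2 μ * eLpNorm u 2 μ)
      atTop (𝓝 0) := by
    simpa using ENNReal.Tendsto.mul_const hlim (Or.inr hu.2.ne)
  refine tendsto_of_tendsto_of_tendsto_of_le_of_le tendsto_const_nhds hbound (fun _ => zero_le)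
    fun n => ?_
  rw [eLpNorm_sub_comm]
  refine le_trans (le_of_eq ?_) (eLpNorm_smul_le_mul_eLpNorm (r := 1) hu.1 (hh.1.sub (hf n)))
  refine congrArg (eLpNorm · 1 μ) (funext fun t => ?_)
  simp only [Pi.sub_apply, Pi.mul_apply, Pi.smul_apply', smul_eq_mul, sub_mul]

theorem tendsto_stepFun_integral_kernelInt {H : ℝ} (hH : H ∈ Ioo (0 : ℝ) 1) {c : ℝ → ℝ}
    (hc : HasJ H c) (hT : 0 < T) (hc2 : IntegrableOn (fun t => J H c t ^ 2) (Ioc 0 T) (dw H))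
    {h : ℝ → ℝ} (hh : MemLp h 2 ((dw H).restrict (Ioc 0 T))) {s : ℕ → StepFun T}
    (hs : Tendsto (fun n => eLpNorm (fun u => h u - (s n).toFun u) 2
      ((dw H).restrict (Ioc 0 T))) atTop (𝓝 0)) :
    Tendsto (fun n => (s n).integral (kernelInt H c)) atTop
      (𝓝 (∫ t in Ioc 0 T, h t * J H c t ∂(dw H))) := by
  simp only [StepFun.integral_kernelInt _ hH hc hT]
  exact tendsto_integral_mul_of_tendsto_eLpNorm_two
    ((memLp_two_iff_integrable_sq (measurable_J H c).aestronglyMeasurable).2 hc2) hh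
    (fun n => (s n).measurable_toFun.aestronglyMeasurable)
    (fun n => (s n).integrable_toFun_mul (hc.integrableOn hH hT)) hs

end StepFunctions

section Observations

variable {Ω : Type*} [MeasurableSpace Ω] {P : Measure Ω} {H : ℝ}

theorem IsFBM.measurable_path {W : ℝ → Ω → ℝ} (hW : IsFBM P H W) :
    Measurable (fun ω (t : ℝ≥0) => W t ω) :=
  measurable_pi_lambda _ fun t => hW.measurable t t.2

theorem IsFBM.covariance_eq {W : ℝ → Ω → ℝ} (hW : IsFBM P H W) (s t : ℝ≥0) :
    cov[W s, W t; P] =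
      ((s : ℝ) ^ (2 * H) + (t : ℝ) ^ (2 * H) - |(s : ℝ) - t| ^ (2 * H)) / 2 := by
  have := hW.gaussian.isProbabilityMeasure
  rw [covariance_eq_sub (hW.gaussian.hasGaussianLaw_eval s).memLp_two
    (hW.gaussian.hasGaussianLaw_eval t).memLp_two, hW.centered s s.2, zero_mul, sub_zero]
  exact hW.covariance t s t.2 s.2

theorem IsFBM.identDistrib_path {W W' : ℝ → Ω → ℝ} (hW : IsFBM P H W) (hW' : IsFBM P H W') :
    IdentDistrib (fun ω (t : ℝ≥0) => W t ω) (fun ω (t : ℝ≥0) => W' t ω) P P where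
  aemeasurable_fst := hW.measurable_path.aemeasurable
  aemeasurable_snd := hW'.measurable_path.aemeasurable
  map_eq := map_eq_of_isGaussianProcess hW.gaussian hW'.gaussian hW.measurable_path.aemeasurable
    hW'.measurable_path.aemeasurable (fun t => by rw [hW.centered t t.2, hW'.centered t t.2])
    fun s t => by rw [hW.covariance_eq, hW'.covariance_eq]

theorem exists_measurable_wienerIntegral {ι : Type*} [Nonempty ι] {W : ι → ℝ → Ω → ℝ}
    (hW : ∀ j, IsFBM P H (W j)) {h : ℝ → ℝ} {t : ℝ} {I : ι → Ω → ℝ}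
    (hI : ∀ j, IsWienerIntegral P H (W j) h t (I j)) :
    ∃ Φ : (ℝ≥0 → ℝ) → ℝ, Measurable Φ ∧ ∀ j, I j =ᵐ[P] fun ω => Φ (fun u : ℝ≥0 => W j u ω) := by
  obtain ⟨s, hs⟩ := (hI (Classical.arbitrary ι)).1
  refine exists_measurable_ae_eq_comp_of_tendstoAESubseq
    (E := fun n p => (s n).integral (fun u => p u.toNNReal))
    (fun i j => (hW i).identDistrib_path (hW j))
    (fun n => (s n).measurable_integral fun u _ => measurable_pi_apply _) fun j => ?_
  refine (tendstoAESubseq_of_tendstoInMeasure ((hI j).2 s hs)).congr_ae fun n => ae_of_all _ ?_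
  exact fun ω => (s n).integral_congr fun u hu => congrArg (W j · ω) (Real.coe_toNNReal u hu.1).symm

variable {a b σ : ℝ → ℝ} {T : ℝ}

/-- What is observed of one subject: `Z_t` is the integral `∫_0^t k_H(t, s) / σ(s) dX_s` along the
path `X` with random effect `φ` and noise `W`, and `I` is the integral `∫_0^T J₂ dZ`. -/
structure IsObservation (P : Measure Ω) (H : ℝ) (a b σ : ℝ → ℝ) (T : ℝ) (φ : Ω → ℝ)
    (W X Z : ℝ → Ω → ℝ) (I : Ω → ℝ) : Prop where
  hasJ : ∀ᵐ ω ∂P, HasJ H (fun s => a (X s ω) / σ s)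
  integrableOn_J₁_sq :
    ∀ᵐ ω ∂P, IntegrableOn (fun t => J₁ H a σ (fun s => X s ω) t ^ 2) (Ioc 0 T) (dw H)
  diffusionIntegral : ∀ t ∈ Icc 0 T,
    IsDiffusionIntegral P H a b σ φ W X (fun s => kernel H t s / σ s) t (Z t)
  semimartingaleIntegral : IsSemimartingaleIntegral P H Z (J₂ H b σ) T I

/-- The martingale part `M_t = ∫_0^t k_H(t, s) dW_s` of the semimartingale `Z`, from the paths `x`
of `X` and `z` of `Z`: it is `z_t` minus the drift `∫_0^t k_H(t, s) / σ(s) (a(x_s) + φ b(s)) ds`. -/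
noncomputable def martingalePart (H : ℝ) (a b σ : ℝ → ℝ) (φ : ℝ) (x z : ℝ → ℝ) (t : ℝ) : ℝ :=
  z t - ∫ s in Ioc 0 t, kernel H t s / σ s * (a (x s) + φ * b s)

theorem integral_kernel_div_mul_add {α β σ : ℝ → ℝ} (r : ℝ)
    (hα : HasJ H (fun s => α s / σ s)) (hβ : HasJ H (fun s => β s / σ s)) {t : ℝ} (ht : 0 ≤ t) :
    ∫ s in Ioc 0 t, kernel H t s / σ s * (α s + r * β s) =
      kernelInt H (fun s => α s / σ s) t + r * kernelInt H (fun s => β s / σ s) t := by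
  rcases ht.eq_or_lt with rfl | ht
  · simp [kernelInt]
  · rw [kernelInt, kernelInt, ← integral_const_mul,
      ← integral_add (hα.1 t ht) ((hβ.1 t ht).const_mul r)]
    refine integral_congr_ae (ae_of_all _ fun s => ?_)
    ring

theorem integral_martingalePart {x : ℝ → ℝ} (hJ₁ : HasJ H (fun s => a (x s) / σ s))
    (hJ₂ : HasJ H (fun s => b s / σ s)) (φ : ℝ) (z : ℝ → ℝ) (s : StepFun T) :
    s.integral (martingalePart H a b σ φ x z) = s.integral z -
      (s.integral (kernelInt H (fun s => a (x s) / σ s)) +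
        φ * s.integral (kernelInt H (fun s => b s / σ s))) := by
  rw [← s.integral_const_mul, ← s.integral_add, ← s.integral_sub]
  exact s.integral_congr fun t ht => by
    rw [martingalePart, integral_kernel_div_mul_add φ hJ₁ hJ₂ ht.1]

theorem IsObservation.tendstoAESubseq_integral_martingalePart (hH : H ∈ Ioo (0 : ℝ) 1)
    (hT : 0 < T) (hJ₂ : HasJ H (fun s => b s / σ s))
    (hJ₂_sq : IntegrableOn (fun t => J₂ H b σ t ^ 2) (Ioc 0 T) (dw H))
    {φ : Ω → ℝ} {W X Z : ℝ → Ω → ℝ} {I : Ω → ℝ} (hobs : IsObservation P H a b σ T φ W X Z I)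
    {s : ℕ → StepFun T} (hs : Tendsto (fun n => eLpNorm (fun u => J₂ H b σ u - (s n).toFun u) 2
      ((dw H).restrict (Ioc 0 T))) atTop (𝓝 0)) :
    TendstoAESubseq P
      (fun n ω => (s n).integral (martingalePart H a b σ (φ ω) (fun t => X t ω) (fun t => Z t ω)))
      (fun ω => I ω - ((∫ t in Ioc 0 T, J₁ H a σ (fun t => X t ω) t * J₂ H b σ t ∂(dw H)) +
        φ ω * ∫ t in Ioc 0 T, J₂ H b σ t ^ 2 ∂(dw H))) := by
  have hJ₂_memLp : MemLp (J₂ H b σ) 2 ((dw H).restrict (Ioc 0 T)) :=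
    (memLp_two_iff_integrable_sq (measurable_J H _).aestronglyMeasurable).2 hJ₂_sq
  have hlim₂ := tendsto_stepFun_integral_kernelInt hH hJ₂ hT hJ₂_sq hJ₂_memLp hs
  have hdrift : ∀ᵐ ω ∂P, Tendsto (fun n =>
      (s n).integral (kernelInt H (fun s => a (X s ω) / σ s)) +
        φ ω * (s n).integral (kernelInt H (fun s => b s / σ s))) atTop
      (𝓝 ((∫ t in Ioc 0 T, J₁ H a σ (fun t => X t ω) t * J₂ H b σ t ∂(dw H)) +
        φ ω * ∫ t in Ioc 0 T, J₂ H b σ t ^ 2 ∂(dw H))) := by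
    filter_upwards [hobs.hasJ, hobs.integrableOn_J₁_sq] with ω hJ₁ hJ₁_sq
    have hlim₁ := tendsto_stepFun_integral_kernelInt hH hJ₁ hT hJ₁_sq hJ₂_memLp hs
    simp only [pow_two, mul_comm (J₁ H a σ _ _)]
    exact hlim₁.add (hlim₂.const_mul (φ ω))
  refine ((tendstoAESubseq_of_tendstoInMeasure
    (hobs.semimartingaleIntegral.2 s hs)).sub_ae hdrift).congr_ae fun n => ?_
  filter_upwards [hobs.hasJ] with ω hJ₁
  exact (integral_martingalePart hJ₁ hJ₂ _ _ (s n)).symm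

variable {ι : Type*} {φ : ι → Ω → ℝ} {W X Z : ι → ℝ → Ω → ℝ} {I : ι → Ω → ℝ}

theorem exists_measurable_phiHat_eq [Nonempty ι] (hH : H ∈ Ioo (0 : ℝ) 1) (hT : 0 < T)
    (hJ₂ : HasJ H (fun s => b s / σ s))
    (hJ₂_sq : IntegrableOn (fun t => J₂ H b σ t ^ 2) (Ioc 0 T) (dw H))
    (hW : ∀ j, IsFBM P H (W j))
    (hobs : ∀ j, IsObservation P H a b σ T (φ j) (W j) (X j) (Z j) (I j)) :
    ∃ Ψ : ℝ × (ℝ≥0 → ℝ) → ℝ, Measurable Ψ ∧ ∀ j,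
      (fun ω => phiHat H a b σ T (fun t => X j t ω) (I j ω)) =ᵐ[P]
        fun ω => Ψ (φ j ω, fun u : ℝ≥0 => W j u ω) := by
  have hmart : ∀ t ∈ Icc 0 T, ∃ Φ : (ℝ≥0 → ℝ) → ℝ, Measurable Φ ∧ ∀ j,
      (fun ω => martingalePart H a b σ (φ j ω) (fun s => X j s ω) (fun s => Z j s ω) t) =ᵐ[P]
        fun ω => Φ (fun u : ℝ≥0 => W j u ω) :=
    fun t ht => exists_measurable_wienerIntegral hW fun j => ((hobs j).diffusionIntegral t ht).2
  choose! Φ hΦ_meas hΦ using hmart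
  obtain ⟨s, hs⟩ := (hobs (Classical.arbitrary ι)).semimartingaleIntegral.1
  set c := ∫ t in Ioc 0 T, J₂ H b σ t ^ 2 ∂(dw H) with hc
  obtain ⟨G, hG_meas, hG⟩ := exists_measurable_ae_eq_comp_of_tendstoAESubseq
    (fun i j => (hW i).identDistrib_path (hW j))
    (fun n => (s n).measurable_integral fun u hu => hΦ_meas u hu) fun j =>
      ((hobs j).tendstoAESubseq_integral_martingalePart hH hT hJ₂ hJ₂_sq hs).congr_ae fun n =>
        (s n).integral_ae_eq fun u hu => hΦ u hu j
  refine ⟨fun p => (G p.2 + p.1 * c) / c, by fun_prop, fun j => ?_⟩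
  filter_upwards [hG j] with ω hω
  simp only [phiHat, ← hc, ← hω]
  ring

theorem iIndepFun_and_identDistrib_phiHat (hH : H ∈ Ioo (0 : ℝ) 1) (hT : 0 < T)
    (hJ₂ : HasJ H (fun s => b s / σ s))
    (hJ₂_sq : IntegrableOn (fun t => J₂ H b σ t ^ 2) (Ioc 0 T) (dw H))
    (hW : ∀ j, IsFBM P H (W j)) (hW_indep : iIndepFun (fun j ω (t : ℝ≥0) => W j t ω) P)
    (hφ : ∀ j, Measurable (φ j)) (hφ_indep : iIndepFun φ P)
    (hφ_ident : ∀ i j, IdentDistrib (φ i) (φ j) P P)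
    (hφW : IndepFun (fun ω j => φ j ω) (fun ω j (t : ℝ≥0) => W j t ω) P)
    (hobs : ∀ j, IsObservation P H a b σ T (φ j) (W j) (X j) (Z j) (I j)) :
    iIndepFun (fun j ω => phiHat H a b σ T (fun t => X j t ω) (I j ω)) P ∧
      ∀ i j, IdentDistrib (fun ω => phiHat H a b σ T (fun t => X i t ω) (I i ω))
        (fun ω => phiHat H a b σ T (fun t => X j t ω) (I j ω)) P P := by
  have := hφ_indep.isProbabilityMeasure
  have hpair_indep : iIndepFun (fun j ω => (φ j ω, fun t : ℝ≥0 => W j t ω)) P :=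
    iIndepFun_prodMk_of_indepFun hφ (fun j => (hW j).measurable_path) hφ_indep hW_indep hφW
  have hpair_ident : ∀ i j, IdentDistrib (fun ω => (φ i ω, fun t : ℝ≥0 => W i t ω))
      (fun ω => (φ j ω, fun t : ℝ≥0 => W j t ω)) P P := fun i j =>
    (hφ_ident i j).prodMk ((hW i).identDistrib_path (hW j))
      (hφW.comp (measurable_pi_apply i) (measurable_pi_apply i))
      (hφW.comp (measurable_pi_apply j) (measurable_pi_apply j))
  rcases isEmpty_or_nonempty ι with _ | _
  · exact ⟨hpair_indep.comp (fun _ _ => 0) (fun _ => measurable_const) |>.congr isEmptyElim,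
      isEmptyElim⟩
  obtain ⟨Ψ, hΨ, hΨ_eq⟩ := exists_measurable_phiHat_eq hH hT hJ₂ hJ₂_sq hW hobs
  refine ⟨(hpair_indep.comp (fun _ => Ψ) fun _ => hΨ).congr fun j => (hΨ_eq j).symm,
    fun i j => ?_⟩
  have h := (hpair_ident i j).comp hΨ
  exact (IdentDistrib.of_ae_eq h.aemeasurable_fst (hΨ_eq i).symm).symm.trans
    (h.trans (IdentDistrib.of_ae_eq h.aemeasurable_snd (hΨ_eq j).symm))

end Observations

section LocalLimitTheorem

open Complex in
theorem integral_exp_intCast_mul_I (n : ℤ) :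
    ∫ θ in (-Real.pi)..Real.pi, exp (n * θ * I) = if n = 0 then 2 * (Real.pi : ℂ) else 0 := by
  split_ifs with hn
  · simp [hn]
    ring
  · have hc : (n : ℂ) * I ≠ 0 := mul_ne_zero (Int.cast_ne_zero.2 hn) I_ne_zero
    have hperiod : exp (n * I * Real.pi) = exp (n * I * ((-Real.pi : ℝ) : ℂ)) :=
      exp_eq_exp_iff_exists_int.2 ⟨n, by push_cast; ring⟩
    simp only [mul_right_comm (n : ℂ) _ I]
    rw [integral_exp_mul_complex hc, hperiod, sub_self, zero_div]

open Complex ComplexConjugate in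
theorem integral_norm_sq_sum_mul_exp {ι : Type*} {s : Finset ι} {n : ι → ℤ} (hn : InjOn n s)
    (c : ι → ℂ) :
    ∫ θ in (-Real.pi)..Real.pi, ‖∑ k ∈ s, c k * exp (n k * θ * I)‖ ^ 2 =
      2 * Real.pi * ∑ k ∈ s, ‖c k‖ ^ 2 := by
  have hexpand : ∀ θ : ℝ, ((‖∑ k ∈ s, c k * exp (n k * θ * I)‖ ^ 2 : ℝ) : ℂ) =
      ∑ k ∈ s, ∑ l ∈ s, c k * conj (c l) * exp ((n k - n l : ℤ) * θ * I) := fun θ => by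
    rw [ofReal_pow, ← mul_conj', map_sum, Finset.sum_mul_sum]
    refine Finset.sum_congr rfl fun k _ => Finset.sum_congr rfl fun l _ => ?_
    have hexp : conj (exp (n l * θ * I)) = exp (-(n l * θ * I)) := by
      rw [← exp_conj]
      simp
    rw [map_mul, hexp, mul_mul_mul_comm, ← exp_add]
    push_cast
    ring_nf
  have hcont : ∀ (z : ℂ) (k : ℤ), IntervalIntegrable (fun θ : ℝ => z * exp (k * θ * I)) volume
      (-Real.pi) Real.pi := fun z k => Continuous.intervalIntegrable (by fun_prop) _ _
  rw [← ofReal_inj, ← intervalIntegral.integral_ofReal]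
  simp only [hexpand]
  rw [intervalIntegral.integral_finsetSum fun k _ =>
    (by fun_prop : Continuous _).intervalIntegrable _ _,
    Finset.mul_sum, ofReal_sum]
  refine Finset.sum_congr rfl fun k hk => ?_
  rw [intervalIntegral.integral_finsetSum fun l _ => hcont _ _, Finset.sum_eq_single_of_mem k hk]
  · rw [intervalIntegral.integral_const_mul, integral_exp_intCast_mul_I, sub_self, if_pos rfl,
      mul_conj']
    push_cast
    ring
  · intro l hl hlk
    rw [intervalIntegral.integral_const_mul, integral_exp_intCast_mul_I,
      if_neg (sub_ne_zero.2 fun h => hlk (hn hk hl h).symm), mul_zero]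

open Complex in
theorem sum_bernsteinPolynomial_mul_exp (N : ℕ) (x θ : ℝ) :
    ∑ k ∈ Finset.range (N + 1), (((bernsteinPolynomial ℝ N k).eval x : ℝ) : ℂ) *
      exp ((k : ℤ) * θ * I) = (x * exp (θ * I) + (1 - x)) ^ N := by
  rw [add_pow]
  refine Finset.sum_congr rfl fun k _ => ?_
  rw [Int.cast_natCast, mul_assoc (k : ℂ), exp_nat_mul, bernsteinPolynomial]
  simp only [Polynomial.eval_mul, Polynomial.eval_natCast, Polynomial.eval_pow, Polynomial.eval_X,
    Polynomial.eval_sub, Polynomial.eval_one]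
  push_cast
  ring

open Complex in
theorem norm_sq_mul_exp_add_one_sub (x θ : ℝ) :
    ‖(x : ℂ) * exp (θ * I) + (1 - x)‖ ^ 2 = 1 - 2 * (x * (1 - x)) * (1 - Real.cos θ) := by
  rw [← normSq_eq_norm_sq, normSq_apply]
  simp only [add_re, add_im, sub_re, sub_im, re_ofReal_mul, im_ofReal_mul, exp_ofReal_mul_I_re,
    exp_ofReal_mul_I_im, one_re, one_im, ofReal_re, ofReal_im]
  linear_combination x ^ 2 * Real.sin_sq_add_cos_sq θ

/-- The sum `∑ p_k(m - 1, x)²` of the squared weights of the Bernstein estimator of order `m`, which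
governs its variance. It is the probability that two independent binomial variables with parameters
`m - 1` and `x` are equal. -/
noncomputable def bernsteinSqSum (m : ℕ) (x : ℝ) : ℝ :=
  ∑ k ∈ Finset.range m, (bernsteinPolynomial ℝ (m - 1) k).eval x ^ 2

theorem two_pi_mul_bernsteinSqSum (N : ℕ) (x : ℝ) :
    2 * Real.pi * bernsteinSqSum (N + 1) x =
      ∫ θ in (-Real.pi)..Real.pi, (1 - 2 * (x * (1 - x)) * (1 - Real.cos θ)) ^ N := by
  have h := integral_norm_sq_sum_mul_exp (s := Finset.range (N + 1)) (n := Nat.cast)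
    Nat.cast_injective.injOn fun k => (((bernsteinPolynomial ℝ N k).eval x : ℝ) : ℂ)
  simpa only [sum_bernsteinPolynomial_mul_exp, norm_pow, pow_right_comm _ N 2,
    norm_sq_mul_exp_add_one_sub, Complex.norm_real, Real.norm_eq_abs, sq_abs, bernsteinSqSum,
    Nat.add_sub_cancel] using h.symm

theorem two_pi_mul_sqrt_mul_bernsteinSqSum {N : ℕ} (hN : N ≠ 0) (x : ℝ) :
    2 * Real.pi * (√N * bernsteinSqSum (N + 1) x) =
      ∫ u, (Ioc (-(Real.pi * √N)) (Real.pi * √N)).indicator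
        (fun u => (1 - 2 * (x * (1 - x)) * (1 - Real.cos (u / √N))) ^ N) u := by
  have hs : 0 < √(N : ℝ) := Real.sqrt_pos.2 (Nat.cast_pos.2 (Nat.pos_of_ne_zero hN))
  have hle : -(Real.pi * √(N : ℝ)) ≤ Real.pi * √N :=
    neg_le_self (mul_nonneg Real.pi_pos.le hs.le)
  rw [integral_indicator measurableSet_Ioc, ← intervalIntegral.integral_of_le hle,
    intervalIntegral.integral_comp_div (fun θ => (1 - 2 * (x * (1 - x)) * (1 - Real.cos θ)) ^ N)
      hs.ne', neg_div, mul_div_cancel_right₀ _ hs.ne', ← two_pi_mul_bernsteinSqSum, smul_eq_mul]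
  ring

theorem tendsto_natCast_mul_one_sub_cos_div_sqrt (u : ℝ) :
    Tendsto (fun N : ℕ => N * (1 - Real.cos (u / √N))) atTop (𝓝 (u ^ 2 / 2)) := by
  have hdiv : Tendsto (fun N : ℕ => u / √(N : ℝ) / 2) atTop (𝓝 0) := by
    simpa using (tendsto_const_nhds.div_atTop
      (Real.tendsto_sqrt_atTop.comp tendsto_natCast_atTop_atTop)).div_const 2
  have hsinc := ((Real.continuous_sinc.tendsto 0).comp hdiv).pow 2 |>.const_mul (u ^ 2 / 2)
  rw [Real.sinc_zero, one_pow, mul_one] at hsinc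
  refine hsinc.congr' ?_
  filter_upwards [eventually_ne_atTop 0] with N hN
  rcases eq_or_ne u 0 with rfl | hu
  · simp
  have : √(N : ℝ) ≠ 0 := Real.sqrt_ne_zero'.2 (Nat.cast_pos.2 (Nat.pos_of_ne_zero hN))
  have hcos := Real.cos_two_mul' (u / √N / 2)
  rw [mul_div_cancel₀ _ two_ne_zero, Real.cos_sq'] at hcos
  rw [Function.comp_apply, Real.sinc_of_ne_zero (by positivity), hcos]
  field_simp
  rw [Real.sq_sqrt N.cast_nonneg]
  ring

theorem tendsto_one_sub_mul_one_sub_cos_div_sqrt_pow (q u : ℝ) :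
    Tendsto (fun N : ℕ => (1 - 2 * q * (1 - Real.cos (u / √N))) ^ N) atTop
      (𝓝 (Real.exp (-q * u ^ 2))) := by
  simp only [sub_eq_add_neg (1 : ℝ) (2 * q * _)]
  refine Real.tendsto_one_add_pow_exp_of_tendsto ?_
  have h := (tendsto_natCast_mul_one_sub_cos_div_sqrt u).const_mul (-(2 * q))
  rw [show -(2 * q) * (u ^ 2 / 2) = -q * u ^ 2 by ring] at h
  exact h.congr fun N => by ring

theorem one_sub_mul_one_sub_cos_pow_le {q : ℝ} (hq₀ : 0 ≤ q) (hq : 4 * q ≤ 1) (N : ℕ) {θ : ℝ}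
    (hθ : |θ| ≤ Real.pi) :
    (1 - 2 * q * (1 - Real.cos θ)) ^ N ≤ Real.exp (-(4 * q / Real.pi ^ 2) * (N * θ ^ 2)) := by
  have hcos := Real.cos_le_one_sub_mul_cos_sq hθ
  have hbase : 0 ≤ 1 - 2 * q * (1 - Real.cos θ) := by nlinarith [Real.neg_one_le_cos θ]
  have hle : 1 - 2 * q * (1 - Real.cos θ) ≤ Real.exp (-(2 * q * (2 / Real.pi ^ 2 * θ ^ 2))) := by
    refine le_trans ?_ (Real.one_sub_le_exp_neg _)
    gcongr
    linarith
  calc (1 - 2 * q * (1 - Real.cos θ)) ^ N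
      ≤ Real.exp (-(2 * q * (2 / Real.pi ^ 2 * θ ^ 2))) ^ N := pow_le_pow_left₀ hbase hle N
    _ = Real.exp (-(4 * q / Real.pi ^ 2) * (N * θ ^ 2)) := by
      rw [← Real.exp_nat_mul]
      ring_nf

theorem norm_indicator_one_sub_mul_one_sub_cos_pow_le {q : ℝ} (hq₀ : 0 ≤ q) (hq : 4 * q ≤ 1)
    (N : ℕ) (u : ℝ) :
    ‖(Ioc (-(Real.pi * √N)) (Real.pi * √N)).indicator
        (fun u => (1 - 2 * q * (1 - Real.cos (u / √N))) ^ N) u‖ ≤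
      Real.exp (-(4 * q / Real.pi ^ 2) * u ^ 2) := by
  by_cases hu : u ∈ Ioc (-(Real.pi * √(N : ℝ))) (Real.pi * √N)
  · have hs : 0 < √(N : ℝ) := by
      by_contra! h
      simp [h.antisymm (Real.sqrt_nonneg _)] at hu
    have hθ : |u / √N| ≤ Real.pi := by
      rw [abs_div, abs_of_pos hs, div_le_iff₀ hs]
      exact abs_le.2 ⟨hu.1.le, hu.2⟩
    have hbase : 0 ≤ 1 - 2 * q * (1 - Real.cos (u / √N)) := by
      nlinarith [Real.neg_one_le_cos (u / √N), Real.cos_le_one (u / √N)]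
    rw [indicator_of_mem hu, Real.norm_of_nonneg (pow_nonneg hbase N)]
    have h := one_sub_mul_one_sub_cos_pow_le hq₀ hq N hθ
    rwa [div_pow, Real.sq_sqrt N.cast_nonneg, mul_div_cancel₀ _ (Real.sqrt_pos.1 hs).ne'] at h
  · rw [indicator_of_notMem hu, norm_zero]
    positivity

theorem two_pi_mul_psi {x : ℝ} (hx : x ∈ Ioo (0 : ℝ) 1) :
    2 * Real.pi * psi x = √(Real.pi / (x * (1 - x))) := by
  have hq : 0 < x * (1 - x) := mul_pos hx.1 (sub_pos.2 hx.2)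
  have hmul : 4 * Real.pi * x * (1 - x) = (2 * Real.pi) ^ 2 / (Real.pi / (x * (1 - x))) := by
    field_simp
    ring
  rw [psi, hmul, Real.rpow_neg (by positivity), ← Real.sqrt_eq_rpow,
    Real.sqrt_div (by positivity), Real.sqrt_sq (by positivity), inv_div,
    mul_div_cancel₀ _ (by positivity)]

theorem tendsto_sqrt_mul_bernsteinSqSum {x : ℝ} (hx : x ∈ Ioo (0 : ℝ) 1) :
    Tendsto (fun N : ℕ => √N * bernsteinSqSum (N + 1) x) atTop (𝓝 (psi x)) := by
  set q := x * (1 - x) with hq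
  have hq₀ : 0 < q := mul_pos hx.1 (sub_pos.2 hx.2)
  have hq₁ : 4 * q ≤ 1 := by nlinarith [sq_nonneg (1 - 2 * x)]
  let F : ℕ → ℝ → ℝ := fun N => (Ioc (-(Real.pi * √N)) (Real.pi * √N)).indicator
    fun u => (1 - 2 * q * (1 - Real.cos (u / √N))) ^ N
  have hF_lim : ∀ u, Tendsto (fun N => F N u) atTop (𝓝 (Real.exp (-q * u ^ 2))) := fun u => by
    refine (tendsto_one_sub_mul_one_sub_cos_div_sqrt_pow q u).congr' ?_
    have hs : Tendsto (fun N : ℕ => Real.pi * √(N : ℝ)) atTop atTop :=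
      (Real.tendsto_sqrt_atTop.comp tendsto_natCast_atTop_atTop).const_mul_atTop Real.pi_pos
    filter_upwards [hs.eventually_gt_atTop |u|] with N hN
    simp only [F, indicator_of_mem (mem_Ioc.2 ⟨(abs_lt.1 hN).1, (abs_lt.1 hN).2.le⟩)]
  have hlim : Tendsto (fun N => ∫ u, F N u) atTop (𝓝 (∫ u, Real.exp (-q * u ^ 2))) :=
    tendsto_integral_of_dominated_convergence
      (fun u => Real.exp (-(4 * q / Real.pi ^ 2) * u ^ 2))
      (fun N => ((by fun_prop : Measurable _).indicator measurableSet_Ioc).aestronglyMeasurable)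
      (integrable_exp_neg_mul_sq (by positivity))
      (fun N => ae_of_all _ (norm_indicator_one_sub_mul_one_sub_cos_pow_le hq₀.le hq₁ N))
      (ae_of_all _ hF_lim)
  rw [integral_gaussian, hq, ← two_pi_mul_psi hx] at hlim
  have hscaled : Tendsto (fun N : ℕ => 2 * Real.pi * (√N * bernsteinSqSum (N + 1) x)) atTop
      (𝓝 (2 * Real.pi * psi x)) := by
    refine hlim.congr' ?_
    filter_upwards [eventually_ne_atTop 0] with N hN
    exact (two_pi_mul_sqrt_mul_bernsteinSqSum hN x).symm
  simpa only [inv_mul_cancel_left₀ Real.two_pi_pos.ne'] using hscaled.const_mul (2 * Real.pi)⁻¹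

end LocalLimitTheorem

section TriangularArrays

theorem norm_exp_mul_I_sub_le {y : ℝ} (hy : |y| ≤ 1) :
    ‖Complex.exp (y * Complex.I) - (1 + y * Complex.I - y ^ 2 / 2)‖ ≤ |y| ^ 3 := by
  have hnorm : ‖(y : ℂ) * Complex.I‖ = |y| := by simp
  have h := Complex.exp_bound (x := y * Complex.I) (hnorm.trans_le hy) (n := 3) (by norm_num)
  have hsum : ∑ k ∈ Finset.range 3, ((y : ℂ) * Complex.I) ^ k / (k.factorial : ℂ) =
      1 + y * Complex.I - y ^ 2 / 2 := by
    simp [Finset.sum_range_succ, mul_pow]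
    ring
  rw [hsum, hnorm] at h
  refine h.trans (mul_le_of_le_one_right (by positivity) ?_)
  norm_num [Nat.factorial]

variable {Ω : Type*} [MeasurableSpace Ω] {P : Measure Ω} [IsProbabilityMeasure P]

theorem norm_charFun_map_sub_le {X : Ω → ℝ} (hX : AEMeasurable X P) {B t : ℝ}
    (hB : ∀ᵐ ω ∂P, |X ω| ≤ B) (ht : |t| * B ≤ 1) :
    ‖charFun (P.map X) t - (1 + (t * P[X] : ℝ) * Complex.I - (t ^ 2 / 2 * ∫ ω, X ω ^ 2 ∂P : ℝ))‖ ≤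
      |t| ^ 3 * B * ∫ ω, X ω ^ 2 ∂P := by
  have hL2 : MemLp X 2 P := .of_bound hX.aestronglyMeasurable B hB
  have hint_exp : Integrable (fun ω => Complex.exp ((t * X ω : ℝ) * Complex.I)) P :=
    .of_bound (by fun_prop) 1 (ae_of_all _ fun ω => (Complex.norm_exp_ofReal_mul_I _).le)
  have hint₁ : Integrable (fun ω => 1 + ((t * X ω : ℝ) : ℂ) * Complex.I) P :=
    (integrable_const 1).add (((hL2.integrable one_le_two).const_mul t).ofReal.mul_const _)
  have hint₂ : Integrable (fun ω => ((t ^ 2 / 2 * X ω ^ 2 : ℝ) : ℂ)) P :=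
    (hL2.integrable_sq.const_mul _).ofReal
  have hint : Integrable
      (fun ω => 1 + ((t * X ω : ℝ) : ℂ) * Complex.I - ((t ^ 2 / 2 * X ω ^ 2 : ℝ) : ℂ)) P :=
    hint₁.sub hint₂
  have hchar : charFun (P.map X) t = ∫ ω, Complex.exp ((t * X ω : ℝ) * Complex.I) ∂P := by
    rw [charFun_apply_real, integral_map hX (by fun_prop)]
    simp only [Complex.ofReal_mul]
  have hpoly : 1 + (t * P[X] : ℝ) * Complex.I - (t ^ 2 / 2 * ∫ ω, X ω ^ 2 ∂P : ℝ) =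
      ∫ ω, (1 + ((t * X ω : ℝ) : ℂ) * Complex.I - ((t ^ 2 / 2 * X ω ^ 2 : ℝ) : ℂ)) ∂P := by
    rw [integral_sub hint₁ hint₂, integral_add (integrable_const 1)
      (((hL2.integrable one_le_two).const_mul t).ofReal.mul_const _), integral_mul_const,
      integral_complex_ofReal, integral_complex_ofReal, integral_const_mul, integral_const_mul,
      integral_const, probReal_univ, one_smul]
  rw [hchar, hpoly, ← integral_sub hint_exp hint, ← integral_const_mul]
  refine norm_integral_le_of_norm_le (hL2.integrable_sq.const_mul _) ?_
  filter_upwards [hB] with ω hω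
  have hle : |t * X ω| ≤ 1 :=
    (abs_mul t _).trans_le ((mul_le_mul_of_nonneg_left hω (abs_nonneg t)).trans ht)
  calc _ = ‖Complex.exp ((t * X ω : ℝ) * Complex.I) -
        (1 + (t * X ω : ℝ) * Complex.I - ((t * X ω : ℝ) : ℂ) ^ 2 / 2)‖ := by
        push_cast
        ring_nf
    _ ≤ |t * X ω| ^ 3 := norm_exp_mul_I_sub_le hle
    _ = |t| ^ 3 * |X ω| * X ω ^ 2 := by rw [abs_mul, ← sq_abs (X ω)]; ring
    _ ≤ |t| ^ 3 * B * X ω ^ 2 := by gcongr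

theorem tendsto_natCast_mul_charFun_map_sub_one {X : ℕ → Ω → ℝ} (hX : ∀ n, AEMeasurable (X n) P)
    {B : ℕ → ℝ} (hB : ∀ n, ∀ᵐ ω ∂P, |X n ω| ≤ B n) (hB_lim : Tendsto B atTop (𝓝 0))
    (hmean : ∀ n, P[X n] = 0) {v : ℝ}
    (hvar : Tendsto (fun n : ℕ => n * Var[X n; P]) atTop (𝓝 v)) (t : ℝ) :
    Tendsto (fun n : ℕ => (n : ℂ) * (charFun (P.map (X n)) t - 1)) atTop
      (𝓝 ((-(t ^ 2 / 2 * v) : ℝ) : ℂ)) := by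
  have hmain : Tendsto (fun n : ℕ => ((-(t ^ 2 / 2 * (n * Var[X n; P])) : ℝ) : ℂ)) atTop
      (𝓝 ((-(t ^ 2 / 2 * v) : ℝ) : ℂ)) :=
    (Complex.continuous_ofReal.tendsto _).comp (hvar.const_mul _).neg
  have herror : Tendsto (fun n : ℕ => |t| ^ 3 * B n * (n * Var[X n; P])) atTop (𝓝 0) := by
    simpa using (hB_lim.const_mul (|t| ^ 3)).mul hvar
  have hsmall : ∀ᶠ n in atTop, |t| * B n ≤ 1 :=
    (hB_lim.const_mul |t|).eventually_le_const (by simp)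
  refine (tendsto_iff_of_dist (squeeze_zero' (.of_forall fun _ => dist_nonneg) ?_ herror)).1 hmain
  filter_upwards [hsmall] with n hn
  have h := norm_charFun_map_sub_le (hX n) (hB n) hn
  rw [hmean, ← variance_of_integral_eq_zero (hX n) (hmean n)] at h
  rw [dist_comm, dist_eq_norm]
  calc _ = ‖(n : ℂ) * (charFun (P.map (X n)) t -
        (1 + (t * 0 : ℝ) * Complex.I - (t ^ 2 / 2 * Var[X n; P] : ℝ)))‖ := by
        push_cast
        ring_nf
    _ ≤ n * (|t| ^ 3 * B n * Var[X n; P]) := by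
        rw [norm_mul, Complex.norm_natCast]
        gcongr
    _ = |t| ^ 3 * B n * (n * Var[X n; P]) := by ring

theorem tendstoInDistribution_sum_triangularArray {X : ℕ → ℕ → Ω → ℝ}
    (hX_indep : ∀ n, iIndepFun (X n) P) (hX_ident : ∀ n j, IdentDistrib (X n j) (X n 0) P P)
    {B : ℕ → ℝ} (hB : ∀ n, ∀ᵐ ω ∂P, |X n 0 ω| ≤ B n) (hB_lim : Tendsto B atTop (𝓝 0))
    (hmean : ∀ n, P[X n 0] = 0) {v : ℝ}
    (hvar : Tendsto (fun n : ℕ => n * Var[X n 0; P]) atTop (𝓝 v)) :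
    TendstoInDistribution (fun n ω => ∑ j ∈ Finset.range n, X n j ω) atTop (id : ℝ → ℝ)
      (fun _ => P) (gaussianReal 0 v.toNNReal) := by
  have hX : ∀ n j, AEMeasurable (X n j) P := fun n j => (hX_ident n j).aemeasurable_fst
  have hv : 0 ≤ v := ge_of_tendsto' hvar fun n => mul_nonneg n.cast_nonneg (variance_nonneg _ _)
  refine ⟨fun n => Finset.aemeasurable_fun_sum _ fun j _ => hX n j, aemeasurable_id, ?_⟩
  refine ProbabilityMeasure.tendsto_iff_tendsto_charFun.2 fun t => ?_
  have hchar : ∀ n, charFun (P.map fun ω => ∑ j ∈ Finset.range n, X n j ω) t =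
      (1 + (charFun (P.map (X n 0)) t - 1)) ^ n := fun n => by
    rw [((hX_indep n).restrict _).charFun_map_fun_finsetSum_eq_prod fun j _ => hX n j]
    simp [fun j => (hX_ident n j).map_eq]
  have hgauss : charFun ((gaussianReal 0 v.toNNReal).map id) t =
      Complex.exp ((-(t ^ 2 / 2 * v) : ℝ) : ℂ) := by
    rw [Measure.map_id, charFun_gaussianReal, Real.coe_toNNReal v hv]
    congr 1
    push_cast
    ring
  simp only [ProbabilityMeasure.coe_mk, hgauss, hchar]
  exact Complex.tendsto_one_add_pow_exp_of_tendsto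
    (tendsto_natCast_mul_charFun_map_sub_one (fun n => hX n 0) hB hB_lim hmean hvar t)

end TriangularArrays

section BernsteinWeights

variable {x : ℝ}

theorem bernsteinPolynomial_eval_nonneg (hx : x ∈ Icc (0 : ℝ) 1) (N k : ℕ) :
    0 ≤ (bernsteinPolynomial ℝ N k).eval x := by
  have hx₀ := hx.1
  have hx₁ := sub_nonneg.2 hx.2
  simp only [bernsteinPolynomial, Polynomial.eval_mul, Polynomial.eval_natCast,
    Polynomial.eval_pow, Polynomial.eval_X, Polynomial.eval_sub, Polynomial.eval_one]
  positivity

theorem sum_bernsteinPolynomial_eval {m : ℕ} (hm : m ≠ 0) (x : ℝ) :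
    ∑ k ∈ Finset.range m, (bernsteinPolynomial ℝ (m - 1) k).eval x = 1 := by
  have h := congrArg (Polynomial.eval x) (bernsteinPolynomial.sum ℝ (m - 1))
  rwa [Nat.sub_add_cancel (Nat.one_le_iff_ne_zero.2 hm), Polynomial.eval_finsetSum,
    Polynomial.eval_one] at h

theorem sum_sq_mul_bernsteinPolynomial_eval (N : ℕ) (x : ℝ) :
    ∑ k ∈ Finset.range (N + 1), (N * x - k) ^ 2 * (bernsteinPolynomial ℝ N k).eval x =
      N * x * (1 - x) := by
  simpa [Polynomial.eval_finsetSum] using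
    congrArg (Polynomial.eval x) (bernsteinPolynomial.variance ℝ N)

/-- The indices of those among the `m` cells of length `1 / m` in `[0, 1]` whose left end point has
distance at least `δ` from `x`. -/
noncomputable def farCells (x δ : ℝ) (m : ℕ) : Finset ℕ :=
  {k ∈ Finset.range m | δ ≤ |(k : ℝ) / m - x|}

theorem half_mul_le_abs_of_mem_farCells (hx : x ∈ Icc (0 : ℝ) 1) {δ : ℝ} {N k : ℕ}
    (hN : 2 ≤ δ * (N + 1 : ℕ)) (hk : k ∈ farCells x δ (N + 1)) :
    δ * (N + 1 : ℕ) / 2 ≤ |N * x - k| := by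
  have hpos : (0 : ℝ) < (N + 1 : ℕ) := by positivity
  have hfar : δ * (N + 1 : ℕ) ≤ |(k : ℝ) - x * (N + 1 : ℕ)| := by
    have h := mul_le_mul_of_nonneg_right (Finset.mem_filter.1 hk).2 hpos.le
    rwa [← abs_of_pos hpos, ← abs_mul, abs_of_pos hpos, sub_mul, div_mul_cancel₀ _ hpos.ne'] at h
  have hshift : |(k : ℝ) - x * (N + 1 : ℕ)| ≤ |N * x - k| + |x| := by
    rw [show (k : ℝ) - x * (N + 1 : ℕ) = -(N * x - k) - x by push_cast; ring, ← abs_neg (N * x - k)]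
    exact abs_sub _ _
  linarith [abs_of_nonneg hx.1, hx.2]

theorem mul_sum_farCells_bernsteinPolynomial_le (hx : x ∈ Icc (0 : ℝ) 1) {δ : ℝ} (hδ : 0 < δ)
    {m : ℕ} (hm : 2 ≤ δ * m) :
    m * ∑ k ∈ farCells x δ m, (bernsteinPolynomial ℝ (m - 1) k).eval x ≤ 1 / δ ^ 2 := by
  obtain ⟨N, rfl⟩ : ∃ N, m = N + 1 := Nat.exists_eq_succ_of_ne_zero fun h => by
    norm_num [h] at hm
  rw [Nat.add_sub_cancel]
  have hnonneg := bernsteinPolynomial_eval_nonneg hx N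
  have hchebyshev : (δ * (N + 1 : ℕ) / 2) ^ 2 *
      ∑ k ∈ farCells x δ (N + 1), (bernsteinPolynomial ℝ N k).eval x ≤ N * x * (1 - x) := by
    rw [← sum_sq_mul_bernsteinPolynomial_eval, Finset.mul_sum]
    refine (Finset.sum_le_sum fun k hk => ?_).trans (Finset.sum_le_sum_of_subset_of_nonneg
      (Finset.filter_subset _ _) fun k _ _ => mul_nonneg (sq_nonneg _) (hnonneg k))
    rw [← sq_abs (N * x - k)]
    gcongr
    · exact hnonneg k
    · exact half_mul_le_abs_of_mem_farCells hx hm hk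
  have hvar : N * x * (1 - x) ≤ ((N + 1 : ℕ) : ℝ) / 4 := by
    push_cast
    nlinarith [mul_nonneg N.cast_nonneg (sq_nonneg (2 * x - 1))]
  have hpos : (0 : ℝ) < (N + 1 : ℕ) := by positivity
  rw [le_div_iff₀ (by positivity)]
  refine le_of_mul_le_mul_left ?_ hpos
  linarith

end BernsteinWeights

section CellIncrements

variable {F : ℝ → ℝ} {G C x : ℝ}

theorem exists_forall_abs_mul_increment_sub_le (hF : HasStrictDerivAt F G x) {ε : ℝ} (hε : 0 < ε) :
    ∃ δ > 0, ∀ᶠ m : ℕ in atTop, ∀ k : ℕ, |(k : ℝ) / m - x| < δ →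
      |m * (F (((k : ℝ) + 1) / m) - F ((k : ℝ) / m)) - G| ≤ ε := by
  obtain ⟨η, hη, hnear⟩ := Metric.eventually_nhds_iff.1
    (Asymptotics.isLittleO_iff.1 (hasStrictDerivAt_iff_hasStrictFDerivAt.1 hF).isLittleO hε)
  refine ⟨η / 2, by positivity, ?_⟩
  filter_upwards [eventually_gt_atTop 0,
    tendsto_natCast_atTop_atTop.eventually_ge_atTop (2 / η)] with m hm hmη k hk
  have hm' : (0 : ℝ) < m := by exact_mod_cast hm
  have hwidth : ((k : ℝ) + 1) / m - (k : ℝ) / m = 1 / m := by ring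
  have hsmall : 1 / (m : ℝ) ≤ η / 2 := by
    rw [div_le_iff₀ hm']
    rw [div_le_iff₀ hη] at hmη
    linarith
  have hk' : |((k : ℝ) + 1) / m - x| < η := by
    have := abs_add_le (1 / (m : ℝ)) ((k : ℝ) / m - x)
    rw [abs_of_pos (by positivity : 0 < 1 / (m : ℝ))] at this
    rw [show ((k : ℝ) + 1) / m - x = 1 / m + ((k : ℝ) / m - x) by ring]
    linarith
  have h := @hnear (((k : ℝ) + 1) / m, (k : ℝ) / m)
    (max_lt hk' (hk.trans (half_lt_self hη)))
  simp only [ContinuousLinearMap.toSpanSingleton_apply, hwidth, smul_eq_mul, Real.norm_eq_abs,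
    abs_of_pos (by positivity : 0 < 1 / (m : ℝ))] at h
  calc |m * (F (((k : ℝ) + 1) / m) - F ((k : ℝ) / m)) - G|
      = m * |F (((k : ℝ) + 1) / m) - F ((k : ℝ) / m) - 1 / m * G| := by
        rw [← abs_of_pos hm', ← abs_mul, abs_of_pos hm']
        congr 1
        field_simp
    _ ≤ m * (ε * (1 / m)) := by gcongr
    _ = ε := by field_simp

theorem abs_mul_sum_mul_increment_sub_le {m : ℕ} {ε δ : ℝ} (hC : ∀ u v, |F v - F u| ≤ C)
    (hnear : ∀ k : ℕ, |(k : ℝ) / m - x| < δ →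
      |m * (F (((k : ℝ) + 1) / m) - F ((k : ℝ) / m)) - G| ≤ ε)
    (hε : 0 ≤ ε) {r : ℕ → ℝ} (hr : ∀ k, 0 ≤ r k) :
    |m * ∑ k ∈ Finset.range m, r k * (F (((k : ℝ) + 1) / m) - F ((k : ℝ) / m)) -
        G * ∑ k ∈ Finset.range m, r k| ≤
      ε * ∑ k ∈ Finset.range m, r k + (C + |G|) * (m * ∑ k ∈ farCells x δ m, r k) := by
  rw [farCells, Finset.sum_filter]
  simp only [Finset.mul_sum]
  rw [← Finset.sum_sub_distrib, ← Finset.sum_add_distrib]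
  refine (Finset.abs_sum_le_sum_abs _ _).trans (Finset.sum_le_sum fun k hk => ?_)
  rw [show m * (r k * (F (((k : ℝ) + 1) / m) - F ((k : ℝ) / m))) - G * r k =
    r k * (m * (F (((k : ℝ) + 1) / m) - F ((k : ℝ) / m)) - G) by ring,
    abs_mul, abs_of_nonneg (hr k)]
  split_ifs with hfar
  · have hm : (1 : ℝ) ≤ m := by
      exact_mod_cast Nat.one_le_iff_ne_zero.2 (Finset.mem_range.1 hk).ne_bot
    have hbound : |m * (F (((k : ℝ) + 1) / m) - F ((k : ℝ) / m)) - G| ≤ m * (C + |G|) :=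
      calc _ ≤ |m * (F (((k : ℝ) + 1) / m) - F ((k : ℝ) / m))| + |G| := abs_sub _ _
        _ ≤ m * C + m * |G| := by
          rw [abs_mul, Nat.abs_cast]
          exact add_le_add (mul_le_mul_of_nonneg_left (hC _ _) m.cast_nonneg)
            (le_mul_of_one_le_left (abs_nonneg G) hm)
        _ = m * (C + |G|) := by ring
    linarith [mul_le_mul_of_nonneg_left hbound (hr k), mul_nonneg hε (hr k)]
  · linarith [mul_le_mul_of_nonneg_left (hnear k (not_le.1 hfar)) (hr k)]

theorem tendsto_mul_sum_mul_increment (hF : HasStrictDerivAt F G x) (hC : ∀ u v, |F v - F u| ≤ C)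
    {r : ℕ → ℕ → ℝ} (hr : ∀ m k, 0 ≤ r m k) {τ : ℝ}
    (hτ : Tendsto (fun m => ∑ k ∈ Finset.range m, r m k) atTop (𝓝 τ))
    (hfar : ∀ δ > 0, Tendsto (fun m : ℕ => m * ∑ k ∈ farCells x δ m, r m k) atTop (𝓝 0)) :
    Tendsto (fun m : ℕ => m * ∑ k ∈ Finset.range m,
      r m k * (F (((k : ℝ) + 1) / m) - F ((k : ℝ) / m))) atTop (𝓝 (G * τ)) := by
  have hτ₀ : 0 ≤ τ := ge_of_tendsto' hτ fun m => Finset.sum_nonneg fun k _ => hr m k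
  suffices hdiff : Tendsto (fun m : ℕ => m * ∑ k ∈ Finset.range m,
      r m k * (F (((k : ℝ) + 1) / m) - F ((k : ℝ) / m)) - G * ∑ k ∈ Finset.range m, r m k)
      atTop (𝓝 0) by
    simpa using hdiff.add (hτ.const_mul G)
  rw [Metric.tendsto_nhds]
  intro η hη
  have hε : 0 < η / (τ + 1) := by positivity
  obtain ⟨δ, hδ, hnear⟩ := exists_forall_abs_mul_increment_sub_le hF hε
  have hlim := (hτ.const_mul (η / (τ + 1))).add ((hfar δ hδ).const_mul (C + |G|))
  have hlt : η / (τ + 1) * τ + (C + |G|) * 0 < η := by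
    rw [mul_zero, add_zero, div_mul_eq_mul_div, div_lt_iff₀ (by positivity)]
    linarith
  filter_upwards [hnear, hlim.eventually_lt_const hlt] with m hm hmη
  rw [Real.dist_0_eq_abs]
  exact (abs_mul_sum_mul_increment_sub_le hC hm hε.le (hr m)).trans_lt hmη

end CellIncrements

section BernsteinKernel

/-- The cell `(k / m, (k + 1) / m]` of the grid on which the Bernstein estimator of order `m` bins
its sample. -/
def cell (m k : ℕ) : Set ℝ := Ioc ((k : ℝ) / m) (((k : ℝ) + 1) / m)

theorem measurableSet_cell (m k : ℕ) : MeasurableSet (cell m k) := measurableSet_Ioc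

theorem indicator_Iic_sub_indicator_Iic_eq_indicator_cell (m k : ℕ) (u : ℝ) :
    (Iic (((k : ℝ) + 1) / m)).indicator (fun _ => (1 : ℝ)) u -
      (Iic ((k : ℝ) / m)).indicator (fun _ => 1) u = (cell m k).indicator (fun _ => 1) u := by
  have hle : (k : ℝ) / m ≤ ((k : ℝ) + 1) / m := by gcongr; linarith
  rw [cell, ← Iic_sdiff_Iic, indicator_sdiff' (Iic_subset_Iic.2 hle)]
  rfl

theorem disjoint_cell {m k l : ℕ} (h : k ≠ l) : Disjoint (cell m k) (cell m l) := by
  wlog hkl : k < l generalizing k l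
  · exact (this h.symm (by lia)).symm
  have hle : ((k : ℝ) + 1) / m ≤ (l : ℝ) / m := by
    gcongr
    exact_mod_cast hkl
  exact Ioc_disjoint_Ioc_of_le hle

theorem measureReal_cell (μ : Measure ℝ) [IsProbabilityMeasure μ] (m k : ℕ) :
    μ.real (cell m k) = cdf μ (((k : ℝ) + 1) / m) - cdf μ ((k : ℝ) / m) := by
  have hle : (k : ℝ) / m ≤ ((k : ℝ) + 1) / m := by gcongr; linarith
  rw [cdf_eq_real, cdf_eq_real, cell, ← Iic_sdiff_Iic,
    measureReal_sdiff (Iic_subset_Iic.2 hle) measurableSet_Iic]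

theorem abs_cdf_sub_cdf_le_one (μ : Measure ℝ) (u v : ℝ) : |cdf μ v - cdf μ u| ≤ 1 :=
  abs_sub_le_iff.2 ⟨by linarith [cdf_le_one μ v, cdf_nonneg μ u],
    by linarith [cdf_le_one μ u, cdf_nonneg μ v]⟩

/-- The contribution of an observation `y` to the Bernstein density estimator of order `m` at `x`:
the estimator is the sample mean of these contributions. -/
noncomputable def bernsteinKernel (m : ℕ) (x y : ℝ) : ℝ :=
  m * ∑ k ∈ Finset.range m,
    (bernsteinPolynomial ℝ (m - 1) k).eval x * (cell m k).indicator (fun _ => (1 : ℝ)) y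

theorem bernsteinEstimator_eq_sum_bernsteinKernel (y : ℕ → ℝ) (m n : ℕ) (x : ℝ) :
    bernsteinEstimator y m n x =
      1 / (n : ℝ) * ∑ j ∈ Finset.range n, bernsteinKernel m x (y j) := by
  simp only [bernsteinEstimator, empCDF, ← mul_sub, ← Finset.sum_sub_distrib,
    indicator_Iic_sub_indicator_Iic_eq_indicator_cell, bernsteinKernel, Finset.mul_sum,
    Finset.sum_mul]
  rw [Finset.sum_comm]
  exact Finset.sum_congr rfl fun j _ => Finset.sum_congr rfl fun k _ => by ring

theorem measurable_bernsteinKernel (m : ℕ) (x : ℝ) : Measurable (bernsteinKernel m x) :=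
  (Finset.measurable_fun_sum _ fun k _ =>
    (measurable_const.indicator (measurableSet_cell m k)).const_mul _).const_mul _

theorem bernsteinKernel_sq (m : ℕ) (x y : ℝ) : bernsteinKernel m x y ^ 2 =
    m ^ 2 * ∑ k ∈ Finset.range m, (bernsteinPolynomial ℝ (m - 1) k).eval x ^ 2 *
      (cell m k).indicator (fun _ => (1 : ℝ)) y := by
  rw [bernsteinKernel, mul_pow, pow_two (∑ k ∈ _, _), Finset.sum_mul_sum]
  congr 1
  refine Finset.sum_congr rfl fun k hk => ?_
  by_cases hy : y ∈ cell m k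
  · rw [Finset.sum_eq_single_of_mem k hk fun l _ hl => by
      simp [Set.disjoint_left.1 (disjoint_cell hl.symm) hy]]
    simp [hy, pow_two]
  · simp [hy]

theorem bernsteinSqSum_nonneg (m : ℕ) (x : ℝ) : 0 ≤ bernsteinSqSum m x :=
  Finset.sum_nonneg fun _ _ => sq_nonneg _

theorem bernsteinKernel_mem_Icc {x : ℝ} (hx : x ∈ Icc (0 : ℝ) 1) (m : ℕ) (y : ℝ) :
    bernsteinKernel m x y ∈ Icc 0 (m * √(bernsteinSqSum m x)) := by
  constructor
  · exact mul_nonneg m.cast_nonneg (Finset.sum_nonneg fun _ _ => mul_nonneg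
      (bernsteinPolynomial_eval_nonneg hx _ _) (indicator_nonneg (fun _ _ => zero_le_one) _))
  · refine (abs_le_of_sq_le_sq' ?_ (by positivity)).2
    rw [mul_pow, Real.sq_sqrt (bernsteinSqSum_nonneg m x), bernsteinKernel_sq, bernsteinSqSum]
    gcongr with k
    exact mul_le_of_le_one_right (sq_nonneg _) (indicator_le_self' (fun _ _ => zero_le_one) y)

end BernsteinKernel

section KernelMoments

variable (μ : Measure ℝ) [IsProbabilityMeasure μ] {x : ℝ}

theorem integral_sum_mul_indicator_cell (m : ℕ) (q : ℕ → ℝ) :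
    ∫ y, ∑ k ∈ Finset.range m, q k * (cell m k).indicator (fun _ => (1 : ℝ)) y ∂μ =
      ∑ k ∈ Finset.range m, q k * (cdf μ (((k : ℝ) + 1) / m) - cdf μ ((k : ℝ) / m)) := by
  rw [integral_finsetSum _ fun k _ =>
    ((integrable_const (1 : ℝ)).indicator (measurableSet_cell m k)).const_mul _]
  refine Finset.sum_congr rfl fun k _ => ?_
  rw [integral_const_mul, integral_indicator (measurableSet_cell m k), ← measureReal_cell]
  simp

theorem integral_bernsteinKernel (m : ℕ) (x : ℝ) : ∫ y, bernsteinKernel m x y ∂μ =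
    m * ∑ k ∈ Finset.range m, (bernsteinPolynomial ℝ (m - 1) k).eval x *
      (cdf μ (((k : ℝ) + 1) / m) - cdf μ ((k : ℝ) / m)) := by
  simp only [bernsteinKernel]
  rw [integral_const_mul, integral_sum_mul_indicator_cell]

theorem integral_bernsteinKernel_sq (m : ℕ) (x : ℝ) : ∫ y, bernsteinKernel m x y ^ 2 ∂μ =
    m ^ 2 * ∑ k ∈ Finset.range m, (bernsteinPolynomial ℝ (m - 1) k).eval x ^ 2 *
      (cdf μ (((k : ℝ) + 1) / m) - cdf μ ((k : ℝ) / m)) := by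
  simp only [bernsteinKernel_sq]
  rw [integral_const_mul, integral_sum_mul_indicator_cell]

variable {μ}

theorem memLp_bernsteinKernel (hx : x ∈ Icc (0 : ℝ) 1) (m : ℕ) (p : ℝ≥0∞) :
    MemLp (bernsteinKernel m x) p μ :=
  .of_bound (measurable_bernsteinKernel m x).aestronglyMeasurable _ (ae_of_all _ fun y => by
    rw [Real.norm_of_nonneg (bernsteinKernel_mem_Icc hx m y).1]
    exact (bernsteinKernel_mem_Icc hx m y).2)

theorem integral_bernsteinKernel_mem_Icc (hx : x ∈ Icc (0 : ℝ) 1) (m : ℕ) :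
    ∫ y, bernsteinKernel m x y ∂μ ∈ Icc 0 (m * √(bernsteinSqSum m x)) := by
  refine ⟨integral_nonneg fun y => (bernsteinKernel_mem_Icc hx m y).1, ?_⟩
  refine (integral_mono ((memLp_bernsteinKernel hx m 1).integrable le_rfl) (integrable_const _)
    fun y => (bernsteinKernel_mem_Icc hx m y).2).trans_eq ?_
  simp

theorem abs_bernsteinKernel_sub_integral_le (hx : x ∈ Icc (0 : ℝ) 1) (m : ℕ) (y : ℝ) :
    |bernsteinKernel m x y - ∫ z, bernsteinKernel m x z ∂μ| ≤ m * √(bernsteinSqSum m x) :=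
  have hK := bernsteinKernel_mem_Icc hx m y
  have hEK := integral_bernsteinKernel_mem_Icc (μ := μ) hx m
  abs_sub_le_iff.2 ⟨(sub_le_self _ hEK.1).trans hK.2, (sub_le_self _ hK.1).trans hEK.2⟩

variable {G : ℝ} {ρ : ℕ → ℝ}

theorem tendsto_abs_mul_integral_bernsteinKernel (hx : x ∈ Icc (0 : ℝ) 1)
    (hG : HasStrictDerivAt (cdf μ) G x) (hρ : Tendsto ρ atTop (𝓝 0)) :
    Tendsto (fun m => |ρ m| * ∫ y, bernsteinKernel m x y ∂μ) atTop (𝓝 0) := by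
  have hρ_abs : Tendsto (fun m => |ρ m|) atTop (𝓝 0) := by simpa using hρ.abs
  have hsum : Tendsto (fun m => ∑ k ∈ Finset.range m,
      |ρ m| * (bernsteinPolynomial ℝ (m - 1) k).eval x) atTop (𝓝 0) := by
    refine hρ_abs.congr' ?_
    filter_upwards [eventually_ne_atTop 0] with m hm
    rw [← Finset.mul_sum, sum_bernsteinPolynomial_eval hm, mul_one]
  have hfar : ∀ δ > 0, Tendsto (fun m : ℕ => m * ∑ k ∈ farCells x δ m,
      |ρ m| * (bernsteinPolynomial ℝ (m - 1) k).eval x) atTop (𝓝 0) := fun δ hδ => by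
    refine squeeze_zero' (.of_forall fun m => mul_nonneg m.cast_nonneg (Finset.sum_nonneg fun k _ =>
      mul_nonneg (abs_nonneg _) (bernsteinPolynomial_eval_nonneg hx _ _))) ?_
      (by simpa using hρ_abs.mul_const (1 / δ ^ 2))
    filter_upwards [(tendsto_natCast_atTop_atTop.const_mul_atTop hδ).eventually_ge_atTop 2]
      with m hm
    rw [← Finset.mul_sum, mul_left_comm]
    gcongr
    exact mul_sum_farCells_bernsteinPolynomial_le hx hδ hm
  have h := tendsto_mul_sum_mul_increment hG (abs_cdf_sub_cdf_le_one μ)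
    (fun m k => mul_nonneg (abs_nonneg _) (bernsteinPolynomial_eval_nonneg hx _ _)) hsum hfar
  rw [mul_zero] at h
  refine h.congr fun m => ?_
  simp only [integral_bernsteinKernel, mul_assoc, ← Finset.mul_sum]
  ring

theorem tendsto_sq_mul_integral_bernsteinKernel_sq (hx : x ∈ Icc (0 : ℝ) 1)
    (hG : HasStrictDerivAt (cdf μ) G x) (hρ : Tendsto ρ atTop (𝓝 0)) {τ : ℝ}
    (hτ : Tendsto (fun m : ℕ => m * ρ m ^ 2 * bernsteinSqSum m x) atTop (𝓝 τ)) :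
    Tendsto (fun m => ρ m ^ 2 * ∫ y, bernsteinKernel m x y ^ 2 ∂μ) atTop (𝓝 (G * τ)) := by
  have hsum : Tendsto (fun m : ℕ => ∑ k ∈ Finset.range m,
      m * ρ m ^ 2 * (bernsteinPolynomial ℝ (m - 1) k).eval x ^ 2) atTop (𝓝 τ) := by
    simpa only [bernsteinSqSum, Finset.mul_sum] using hτ
  have hfar : ∀ δ > 0, Tendsto (fun m : ℕ => m * ∑ k ∈ farCells x δ m,
      m * ρ m ^ 2 * (bernsteinPolynomial ℝ (m - 1) k).eval x ^ 2) atTop (𝓝 0) := fun δ hδ => by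
    refine squeeze_zero' (.of_forall fun m => by positivity) ?_
      (by simpa using (hρ.pow 2).mul_const ((1 / δ ^ 2) ^ 2))
    filter_upwards [(tendsto_natCast_atTop_atTop.const_mul_atTop hδ).eventually_ge_atTop 2]
      with m hm
    have hnonneg := fun k => bernsteinPolynomial_eval_nonneg hx (m - 1) k
    calc m * ∑ k ∈ farCells x δ m, m * ρ m ^ 2 * (bernsteinPolynomial ℝ (m - 1) k).eval x ^ 2
        = ρ m ^ 2 * (m ^ 2 *
            ∑ k ∈ farCells x δ m, (bernsteinPolynomial ℝ (m - 1) k).eval x ^ 2) := by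
          rw [← Finset.mul_sum]
          ring
      _ ≤ ρ m ^ 2 * (m * ∑ k ∈ farCells x δ m, (bernsteinPolynomial ℝ (m - 1) k).eval x) ^ 2 := by
          rw [mul_pow]
          gcongr
          exact Finset.sum_sq_le_sq_sum_of_nonneg fun k _ => hnonneg k
      _ ≤ ρ m ^ 2 * (1 / δ ^ 2) ^ 2 := by
          gcongr
          · exact mul_nonneg m.cast_nonneg (Finset.sum_nonneg fun k _ => hnonneg k)
          · exact mul_sum_farCells_bernsteinPolynomial_le hx hδ hm
  refine (tendsto_mul_sum_mul_increment hG (abs_cdf_sub_cdf_le_one μ)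
    (fun m k => by positivity) hsum hfar).congr fun m => ?_
  simp only [integral_bernsteinKernel_sq, mul_assoc, ← Finset.mul_sum]
  ring

theorem tendsto_sq_mul_variance_bernsteinKernel (hx : x ∈ Icc (0 : ℝ) 1)
    (hG : HasStrictDerivAt (cdf μ) G x) (hρ : Tendsto ρ atTop (𝓝 0)) {τ : ℝ}
    (hτ : Tendsto (fun m : ℕ => m * ρ m ^ 2 * bernsteinSqSum m x) atTop (𝓝 τ)) :
    Tendsto (fun m => ρ m ^ 2 * Var[bernsteinKernel m x; μ]) atTop (𝓝 (G * τ)) := by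
  have h := (tendsto_sq_mul_integral_bernsteinKernel_sq hx hG hρ hτ).sub
    ((tendsto_abs_mul_integral_bernsteinKernel hx hG hρ).pow 2)
  rw [zero_pow two_ne_zero, sub_zero] at h
  refine h.congr fun m => ?_
  rw [variance_eq_sub (memLp_bernsteinKernel hx m 2), mul_pow, sq_abs, mul_sub]
  rfl

end KernelMoments

section BernsteinEstimator

variable {Ω : Type*} [MeasurableSpace Ω] {P : Measure Ω} {Y : ℕ → Ω → ℝ} {x : ℝ}

theorem integral_bernsteinKernel_comp (hY_ident : ∀ j, IdentDistrib (Y j) (Y 0) P P)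
    (m j : ℕ) :
    ∫ ω, bernsteinKernel m x (Y j ω) ∂P = ∫ y, bernsteinKernel m x y ∂(P.map (Y 0)) := by
  rw [← (hY_ident j).map_eq, integral_map (hY_ident j).aemeasurable_fst
    (measurable_bernsteinKernel m x).aestronglyMeasurable]

variable [IsProbabilityMeasure P]

theorem IsDensity.hasStrictDerivAt_cdf {V : Ω → ℝ} {g : ℝ → ℝ} (hg : IsDensity P V g)
    (hgx : ContinuousAt g x) : HasStrictDerivAt (cdf (P.map V)) (g x) x := by
  obtain ⟨hV, hg_meas, hg_nonneg, hlaw⟩ := hg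
  have := Measure.isProbabilityMeasure_map hV
  have hg_int : Integrable g := by
    refine ⟨hg_meas.aestronglyMeasurable, ?_⟩
    rw [hasFiniteIntegral_iff_ofReal (ae_of_all _ hg_nonneg), ← setLIntegral_univ,
      ← withDensity_apply _ .univ, ← hlaw]
    exact measure_lt_top _ _
  have hcdf : ∀ u, cdf (P.map V) u = ∫ y in Iic u, g y := fun u => by
    rw [cdf_eq_real, Measure.real, hlaw, withDensity_apply _ measurableSet_Iic,
      integral_eq_lintegral_of_nonneg_ae (ae_of_all _ hg_nonneg) hg_meas.aestronglyMeasurable]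
  have hcdf_eq : (fun u => (∫ y in Iic x, g y) + ∫ y in x..u, g y) = cdf (P.map V) := by
    ext u
    rw [hcdf, ← intervalIntegral.integral_Iic_sub_Iic hg_int.integrableOn hg_int.integrableOn,
      add_sub_cancel]
  rw [← hcdf_eq]
  exact (intervalIntegral.integral_hasStrictDerivAt_right hg_int.intervalIntegrable
    hg_meas.stronglyMeasurable.stronglyMeasurableAtFilter hgx).const_add _

theorem rpow_half_mul_one_div_natCast (n : ℕ) :
    (n : ℝ) ^ (1 / 2 : ℝ) * (1 / (n : ℝ)) = (√n)⁻¹ := by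
  rw [← Real.sqrt_eq_rpow, mul_one_div, Real.sqrt_div_self', one_div]

theorem sqrt_mul_bernsteinEstimator_sub_integral (hx : x ∈ Icc (0 : ℝ) 1)
    (hY_ident : ∀ j, IdentDistrib (Y j) (Y 0) P P) (m n : ℕ) (r : ℝ) (ω : Ω) :
    (n : ℝ) ^ (1 / 2 : ℝ) * r * (bernsteinEstimator (fun j => Y j ω) m n x -
        ∫ ω', bernsteinEstimator (fun j => Y j ω') m n x ∂P) =
      ∑ j ∈ Finset.range n, (√n)⁻¹ * r *
        (bernsteinKernel m x (Y j ω) - ∫ y, bernsteinKernel m x y ∂(P.map (Y 0))) := by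
  have hint : ∀ j, Integrable (fun ω => bernsteinKernel m x (Y j ω)) P := fun j =>
    have := Measure.isProbabilityMeasure_map (hY_ident j).aemeasurable_fst
    ((memLp_bernsteinKernel hx m 1).integrable le_rfl).comp_aemeasurable
      (hY_ident j).aemeasurable_fst
  simp only [bernsteinEstimator_eq_sum_bernsteinKernel]
  rw [integral_const_mul, integral_finsetSum _ fun j _ => hint j, ← mul_sub,
    ← Finset.sum_sub_distrib, ← Finset.mul_sum, ← rpow_half_mul_one_div_natCast]
  simp only [integral_bernsteinKernel_comp hY_ident]
  ring

theorem tendstoInDistribution_sum_comp (hY_indep : iIndepFun Y P)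
    (hY_ident : ∀ j, IdentDistrib (Y j) (Y 0) P P) {ζ : ℕ → ℝ → ℝ} (hζ : ∀ n, Measurable (ζ n))
    {B : ℕ → ℝ} (hB : ∀ n y, |ζ n y| ≤ B n) (hB_lim : Tendsto B atTop (𝓝 0))
    (hmean : ∀ n, ∫ y, ζ n y ∂(P.map (Y 0)) = 0) {v : ℝ}
    (hvar : Tendsto (fun n : ℕ => n * Var[ζ n; P.map (Y 0)]) atTop (𝓝 v)) :
    TendstoInDistribution (fun n ω => ∑ j ∈ Finset.range n, ζ n (Y j ω)) atTop (id : ℝ → ℝ)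
      (fun _ => P) (gaussianReal 0 v.toNNReal) := by
  have hY := (hY_ident 0).aemeasurable_fst
  refine tendstoInDistribution_sum_triangularArray (X := fun n j => ζ n ∘ Y j)
    (fun n => hY_indep.comp _ fun _ => hζ n) (fun n j => (hY_ident j).comp (hζ n))
    (fun n => ae_of_all _ fun ω => hB n _) hB_lim (fun n => ?_) ?_
  · exact (integral_map hY (hζ n).aestronglyMeasurable).symm.trans (hmean n)
  · simpa only [variance_map (hζ _).aemeasurable hY] using hvar

theorem tendstoInDistribution_bernsteinEstimator (hY_indep : iIndepFun Y P)
    (hY_ident : ∀ j, IdentDistrib (Y j) (Y 0) P P) (hx : x ∈ Icc (0 : ℝ) 1) {G : ℝ}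
    (hG : HasStrictDerivAt (cdf (P.map (Y 0))) G x) {m : ℕ → ℕ} (hm : Tendsto m atTop atTop)
    (hmn : Tendsto (fun n => (m n : ℝ) / n) atTop (𝓝 0)) {ρ : ℕ → ℝ}
    (hρ : Tendsto ρ atTop (𝓝 0)) {τ : ℝ}
    (hτ : Tendsto (fun m : ℕ => m * ρ m ^ 2 * bernsteinSqSum m x) atTop (𝓝 τ)) :
    TendstoInDistribution
      (fun (n : ℕ) ω => (n : ℝ) ^ (1 / 2 : ℝ) * ρ (m n) *
        (bernsteinEstimator (fun j => Y j ω) (m n) n x -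
          ∫ ω', bernsteinEstimator (fun j => Y j ω') (m n) n x ∂P))
      atTop (id : ℝ → ℝ) (fun _ => P) (gaussianReal 0 (G * τ).toNNReal) := by
  set μ := P.map (Y 0)
  have : IsProbabilityMeasure μ :=
    Measure.isProbabilityMeasure_map (hY_ident 0).aemeasurable_fst
  simp only [sqrt_mul_bernsteinEstimator_sub_integral hx hY_ident]
  refine tendstoInDistribution_sum_comp hY_indep hY_ident (ζ := fun n y => (√n)⁻¹ * ρ (m n) *
      (bernsteinKernel (m n) x y - ∫ z, bernsteinKernel (m n) x z ∂μ))
    (B := fun n => √(m n / n * (m n * ρ (m n) ^ 2 * bernsteinSqSum (m n) x)))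
    (fun n => ((measurable_bernsteinKernel (m n) x).sub_const _).const_mul _) (fun n y => ?_)
    (by simpa using (hmn.mul (hτ.comp hm)).sqrt) (fun n => ?_) ?_
  · refine Real.abs_le_sqrt ?_
    have hsq := pow_le_pow_left₀ (abs_nonneg _)
      (abs_bernsteinKernel_sub_integral_le (μ := μ) hx (m n) y) 2
    rw [sq_abs, mul_pow, Real.sq_sqrt (bernsteinSqSum_nonneg _ x)] at hsq
    rw [mul_pow, mul_pow, inv_pow, Real.sq_sqrt n.cast_nonneg]
    calc _ ≤ (n : ℝ)⁻¹ * ρ (m n) ^ 2 * (m n ^ 2 * bernsteinSqSum (m n) x) := by gcongr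
      _ = m n / n * (m n * ρ (m n) ^ 2 * bernsteinSqSum (m n) x) := by ring
  · rw [integral_const_mul,
      integral_sub ((memLp_bernsteinKernel hx _ 1).integrable le_rfl) (integrable_const _)]
    simp [μ]
  · refine ((tendsto_sq_mul_variance_bernsteinKernel hx hG hρ hτ).comp hm).congr' ?_
    filter_upwards [eventually_ne_atTop 0] with n hn
    rw [variance_const_mul,
      variance_sub_const (measurable_bernsteinKernel _ x).aestronglyMeasurable, mul_pow, inv_pow,
      Real.sq_sqrt n.cast_nonneg, ← mul_assoc, ← mul_assoc,
      mul_inv_cancel₀ (Nat.cast_ne_zero.2 hn), one_mul, Function.comp_apply]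

end BernsteinEstimator

section Rates

variable {x : ℝ}

theorem tendsto_natCast_rpow_neg {r : ℝ} (hr : 0 < r) :
    Tendsto (fun m : ℕ => (m : ℝ) ^ (-r)) atTop (𝓝 0) :=
  (tendsto_rpow_neg_atTop hr).comp tendsto_natCast_atTop_atTop

theorem mul_rpow_neg_one_fourth_sq (m : ℕ) : (m : ℝ) * ((m : ℝ) ^ (-(1 / 4) : ℝ)) ^ 2 = √m := by
  rcases eq_or_ne m 0 with rfl | hm
  · simp
  have hpos : (0 : ℝ) < m := by positivity
  rw [← Real.rpow_natCast, ← Real.rpow_mul hpos.le, Real.sqrt_eq_rpow]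
  nth_rewrite 1 [← Real.rpow_one (m : ℝ)]
  rw [← Real.rpow_add hpos]
  norm_num

theorem tendsto_mul_rpow_sq_mul_bernsteinSqSum (hx : x ∈ Ioo (0 : ℝ) 1) :
    Tendsto (fun m : ℕ => m * ((m : ℝ) ^ (-(1 / 4) : ℝ)) ^ 2 * bernsteinSqSum m x) atTop
      (𝓝 (psi x)) := by
  simp only [mul_rpow_neg_one_fourth_sq]
  rw [← tendsto_add_atTop_iff_nat 1]
  have hratio : Tendsto (fun N : ℕ => √(1 + 1 / (N : ℝ))) atTop (𝓝 1) := by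
    simpa using (tendsto_one_div_atTop_nhds_zero_nat.const_add (1 : ℝ)).sqrt
  have h := hratio.mul (tendsto_sqrt_mul_bernsteinSqSum hx)
  rw [one_mul] at h
  refine h.congr' ?_
  filter_upwards [eventually_ne_atTop 0] with N hN
  have hN' : (N : ℝ) ≠ 0 := Nat.cast_ne_zero.2 hN
  rw [← mul_assoc, ← Real.sqrt_mul (by positivity), add_mul, one_mul, one_div_mul_cancel hN',
    Nat.cast_add_one]

theorem bernsteinSqSum_eq_one (hx : x ∈ ({0, 1} : Set ℝ)) {m : ℕ} (hm : m ≠ 0) :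
    bernsteinSqSum m x = 1 := by
  have hm' := Nat.pos_of_ne_zero hm
  rcases hx with rfl | rfl
  · rw [bernsteinSqSum, Finset.sum_eq_single 0] <;>
      simp +contextual [bernsteinPolynomial.eval_at_0, hm]
  · rw [bernsteinSqSum, Finset.sum_eq_single (m - 1)] <;>
      simp +contextual [bernsteinPolynomial.eval_at_1, hm']

theorem tendsto_mul_rpow_sq_mul_bernsteinSqSum_of_mem_pair (hx : x ∈ ({0, 1} : Set ℝ)) :
    Tendsto (fun m : ℕ => m * ((m : ℝ) ^ (-(1 / 2) : ℝ)) ^ 2 * bernsteinSqSum m x) atTop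
      (𝓝 1) := by
  refine tendsto_const_nhds.congr' ?_
  filter_upwards [eventually_ne_atTop 0] with m hm
  have hm' : (m : ℝ) ≠ 0 := Nat.cast_ne_zero.2 hm
  rw [bernsteinSqSum_eq_one hx hm, Real.rpow_neg m.cast_nonneg, ← Real.sqrt_eq_rpow, inv_pow,
    Real.sq_sqrt m.cast_nonneg, mul_inv_cancel₀ hm', mul_one]

end Rates

end FracRE

open FracRE in
theorem theorem1_general {Ω : Type*} [MeasurableSpace Ω] (P : Measure Ω) [IsProbabilityMeasure P]
    (H : ℝ) (hH : H ∈ Ioo (1 / 2 : ℝ) 1) (T : ℝ) (hT : 0 < T) (x₀ : ℝ)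
    (a b σ : ℝ → ℝ) (hσ : ∀ t, 0 ≤ t → σ t ≠ 0)
    (W : ℕ → ℝ → Ω → ℝ) (hW : ∀ j, IsFBM P H (W j))
    (hW_indep : iIndepFun (fun j ω (t : ℝ≥0) => W j t ω) P)
    (φ : ℕ → Ω → ℝ) (hφ : ∀ j, Measurable (φ j)) (hφ_indep : iIndepFun φ P)
    (hφ_ident : ∀ i j, IdentDistrib (φ i) (φ j) P P)
    (hφW : IndepFun (fun ω j => φ j ω) (fun ω j (t : ℝ≥0) => W j t ω) P)
    (X : ℕ → ℝ → Ω → ℝ) (hX : ∀ j, IsSolution P H a b σ x₀ (φ j) (W j) (X j))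
    (hJ₂ : HasJ H (fun s => b s / σ s))
    (hJ₂_sq : IntegrableOn (fun t => J₂ H b σ t ^ 2) (Ioc 0 T) (dw H))
    (Z : ℕ → ℝ → Ω → ℝ) (I : ℕ → Ω → ℝ)
    (hobs : ∀ j, IsObservation P H a b σ T (φ j) (W j) (X j) (Z j) (I j))
    (Y : ℕ → Ω → ℝ) (hY : ∀ j ω, Y j ω = phiHat H a b σ T (fun t => X j t ω) (I j ω))
    (x : ℝ) (g : ℝ → ℝ) (hg_density : IsDensity P (Y 0) g) (hg_cont : ContinuousAt g x)
    (m : ℕ → ℕ) (hm : Tendsto m atTop atTop)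
    (hmn : Tendsto (fun n => (m n : ℝ) / n) atTop (𝓝 0)) :
    (x ∈ Ioo (0 : ℝ) 1 →
      TendstoInDistribution
        (fun (n : ℕ) ω => (n : ℝ) ^ (1 / 2 : ℝ) * (m n : ℝ) ^ (-(1 / 4) : ℝ) *
          (bernsteinEstimator (fun j => Y j ω) (m n) n x -
            ∫ ω', bernsteinEstimator (fun j => Y j ω') (m n) n x ∂P))
        atTop (id : ℝ → ℝ) (fun _ => P) (gaussianReal 0 (g x * psi x).toNNReal)) ∧
    (x ∈ ({0, 1} : Set ℝ) →
      TendstoInDistribution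
        (fun (n : ℕ) ω => (n : ℝ) ^ (1 / 2 : ℝ) * (m n : ℝ) ^ (-(1 / 2) : ℝ) *
          (bernsteinEstimator (fun j => Y j ω) (m n) n x -
            ∫ ω', bernsteinEstimator (fun j => Y j ω') (m n) n x ∂P))
        atTop (id : ℝ → ℝ) (fun _ => P) (gaussianReal 0 (g x).toNNReal)) := by
  obtain ⟨hY_indep, hY_ident⟩ : iIndepFun Y P ∧ ∀ i j, IdentDistrib (Y i) (Y j) P P := by
    simp only [funext fun j => funext (hY j)]
    exact iIndepFun_and_identDistrib_phiHat ⟨by linarith [hH.1], hH.2⟩ hT hJ₂ hJ₂_sq hW hW_indep hφ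
      hφ_indep hφ_ident hφW hobs
  have hcdf := hg_density.hasStrictDerivAt_cdf hg_cont
  refine ⟨fun hx => ?_, fun hx => ?_⟩
  · exact tendstoInDistribution_bernsteinEstimator hY_indep (hY_ident · 0) (Ioo_subset_Icc_self hx)
      hcdf hm hmn (tendsto_natCast_rpow_neg (by norm_num))
      (tendsto_mul_rpow_sq_mul_bernsteinSqSum hx)
  · have hx' : x ∈ Icc (0 : ℝ) 1 := by rcases hx with rfl | rfl <;> simp
    simpa only [mul_one] using tendstoInDistribution_bernsteinEstimator hY_indep (hY_ident · 0) hx'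
      hcdf hm hmn (tendsto_natCast_rpow_neg (by norm_num))
      (tendsto_mul_rpow_sq_mul_bernsteinSqSum_of_mem_pair hx)

open FracRE in
theorem theorem1 {Ω : Type*} [MeasurableSpace Ω] (P : Measure Ω) [IsProbabilityMeasure P]
    -- the model
    (H : ℝ) (hH : H ∈ Ioo (1 / 2 : ℝ) 1) (T : ℝ) (hT : 0 < T) (x₀ : ℝ)
    (a b σ : ℝ → ℝ) (ha : Measurable a) (hb : Measurable b) (hσ : Measurable σ)
    (hσ_pos : ∀ t, 0 ≤ t → 0 < σ t)
    (W : ℕ → ℝ → Ω → ℝ) (hW : ∀ j, IsFBM P H (W j))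
    (hW_indep : iIndepFun (fun j ω (t : ℝ≥0) => W j t ω) P)
    (φ : ℕ → Ω → ℝ) (hφ : ∀ j, Measurable (φ j)) (hφ_indep : iIndepFun φ P)
    (f : ℝ → ℝ) (hφ_density : ∀ j, IsDensity P (φ j) f)
    (hf_supp : ∀ y, y ∉ Icc (0 : ℝ) 1 → f y = 0)
    (hφW : IndepFun (fun ω j => φ j ω) (fun ω j (t : ℝ≥0) => W j t ω) P)
    (X : ℕ → ℝ → Ω → ℝ) (hX : ∀ j, IsSolution P H a b σ x₀ (φ j) (W j) (X j))
    -- `J₂` and `J₁` are well defined, and `J₁` is square integrable for `dw`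
    (hJ₂ : HasJ H (fun s => b s / σ s))
    (hJ₁ : ∀ j, ∀ᵐ ω ∂P, HasJ H (fun s => a (X j s ω) / σ s) ∧
      ∀ S, 0 < S → IntegrableOn (fun t => J₁ H a σ (fun s => X j s ω) t ^ 2) (Ioc 0 S) (dw H))
    -- `Z j t = ∫_0^t k_H(t, s) / σ(s) dX^j_s`
    (Z : ℕ → ℝ → Ω → ℝ)
    (hZ : ∀ j, ∀ t ∈ Icc 0 T, IsDiffusionIntegral P H a b σ (φ j) (W j) (X j)
      (fun s => kernel H t s / σ s) t (Z j t))
    -- `I j = ∫_0^T J₂ dZ^j`, and `Y j` is the estimator of the random effect `φ j`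
    (I : ℕ → Ω → ℝ) (hI : ∀ j, IsSemimartingaleIntegral P H (Z j) (J₂ H b σ) T (I j))
    (Y : ℕ → Ω → ℝ) (hY : ∀ j ω, Y j ω = phiHat H a b σ T (fun t => X j t ω) (I j ω))
    -- (A1), (A2), (A3)
    (hA1 : ∀ S, 0 < S → IntegrableOn (fun t => J₂ H b σ t ^ 2) (Ioc 0 S) (dw H))
    (hA2 : Tendsto (fun S => ∫ t in Ioc 0 S, J₂ H b σ t ^ 2 ∂(dw H)) atTop atTop)
    (hA3 : ContDiffOn ℝ 2 f (Icc 0 1))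
    -- (A4)
    (x : ℝ) (g : ℝ → ℝ) (hg_density : IsDensity P (Y 0) g) (hg_pos : ∀ y, 0 < g y)
    (hg_cont : ContinuousAt g x)
    -- the order of the Bernstein polynomials
    (m : ℕ → ℕ) (hm : Tendsto m atTop atTop)
    (hmn : Tendsto (fun n => (m n : ℝ) / n) atTop (𝓝 0)) :
    (x ∈ Ioo (0 : ℝ) 1 →
      TendstoInDistribution
        (fun (n : ℕ) ω => (n : ℝ) ^ (1 / 2 : ℝ) * (m n : ℝ) ^ (-(1 / 4) : ℝ) *
          (bernsteinEstimator (fun j => Y j ω) (m n) n x -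
            ∫ ω', bernsteinEstimator (fun j => Y j ω') (m n) n x ∂P))
        atTop (id : ℝ → ℝ) (fun _ => P) (gaussianReal 0 (g x * psi x).toNNReal)) ∧
    (x ∈ ({0, 1} : Set ℝ) →
      TendstoInDistribution
        (fun (n : ℕ) ω => (n : ℝ) ^ (1 / 2 : ℝ) * (m n : ℝ) ^ (-(1 / 2) : ℝ) *
          (bernsteinEstimator (fun j => Y j ω) (m n) n x -
            ∫ ω', bernsteinEstimator (fun j => Y j ω') (m n) n x ∂P))
        atTop (id : ℝ → ℝ) (fun _ => P) (gaussianReal 0 (g x).toNNReal)) := by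
  exact theorem1_general P H hH T hT x₀ a b σ (fun t ht => (hσ_pos t ht).ne') W hW hW_indep φ hφ
    hφ_indep (fun i j => ⟨(hφ_density i).1, (hφ_density j).1,
      (hφ_density i).2.2.2.trans (hφ_density j).2.2.2.symm⟩) hφW X hX hJ₂ (hA1 T hT) Z I
    (fun j => ⟨(hJ₁ j).mono fun _ h => h.1, (hJ₁ j).mono fun _ h => h.2 T hT, hZ j, hI j⟩) Y hY x g
    hg_density hg_cont m hm hmn
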